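/- **Theorem (Exact representation of a $k$-th order smooth function as a linear combination of $\le k$-th order splines).** *Notation.* Let $d\ge 0$ and $k\ge 1$ be integers. For $s\subset\{1,\dots,d\}$ and $x\in[0,1]^d$ write $x(s)=(x_i)_{i\in s}$, and let $(x(s),0(-s))$ be $x$ with the coordinates outside $s$ set to $0$; $(a,b]$ denotes the box $\prod_i(a_i,b_i]$ and $\mu$ Lebesgue measure. Let $\mathcal S^{n}(d)$ be the set of $\bar s(n)=(s_1,\dots,s_{n})$ with $s_{n}\subset\dots\subset s_1\subset\{1,\dots,d\}$ (empty sets allowed), and $\bar s(j)=(s_1,\dots,s_j)$. If $s_{k+1}=\emptyset$, let $m=m(\bar s(k+1))\in\{0,\dots,k\}$ be the smallest $m$ with $s_{m+1}=\emptyset$. *Measures and variation.* For $f:[0,1]^s\to\mathbb R$ let $\Delta_{(a,b]}f$ be the generalized difference of $f$ across the corners of $(a,b]$. The variation norm $\|f\|_v$ is the supremum of $\sum_J|\Delta_Jf|$ over finite families of disjoint boxes $J=(a,b]\subset(0,1]^s$. The signed measure $df$ generated by $f$ (if it exists it is unique) is the signed measure on $(0,1]^s$ with $df((a,b])=\Delta_{(a,b]}f$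 for all $0\le a\le b\le1$. A function $f$ is cadlag if at every point of the cube it has limits along all quadrants and the limit along the upper right quadrant is the value of $f$. *Derivatives and the class.* Let $Q:[0,1]^d\to\mathbb R$. A family of sequential derivatives of $Q$ up to order $k$ consists of functions $Q^{(j)}_{\bar s(j)}:[0,1]^{s_j}\to\mathbb R$, $0\le j\le k$, with $Q^{(0)}=Q$, such that for $j<k$ and nonempty $s_{j+1}\subset\dots\subset s_1$ the section $Q^{(j)}_{\bar s(j+1)}(x(s_{j+1}))=Q^{(j)}_{\bar s(j)}(x(s_{j+1}),0(s_j\setminus s_{j+1}))$ generates a signed measure on $(0,1]^{s_{j+1}}$ which is absolutely continuous with respect to Lebesgue measure, with integrable density $Q^{(j+1)}_{\bar s(j+1)}=dQ^{(j)}_{\bar s(j+1)}/d\mu$; here $s_0=\{1,\dots,d\}$. The class $D^{(k)}([0,1]^d)$ is the set of $Q$ that have such a family for which moreover, for each $\bar s(k+1)$ with $s_{k+1}\ne\emptyset$, the section $Q^{(k)}_{\bar s(k+1)}$ of $Q^{(k)}_{\bar s(k)}$ is cadlag on $[0,1]^{s_{k+1}}$ with $\|Q^{(k)}_{\bar s(k+1)}\|_v<\infty$.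 For $s_{k+1}=\emptyset$ one lets $Q^{(k)}_{\bar s(k+1)}$ be the constant $Q^{(m)}_{\bar s(m)}(0(s_m))$ (so $Q(0)$ if $s_1=\emptyset$), with variation norm its absolute value. The $k$-th order sectional variation norm is $\|Q\|^*_{v,k}=\sum_{\bar s(k+1)\in\mathcal S^{k+1}(d)}\|Q^{(k)}_{\bar s(k+1)}\|_v$. *Splines and primitives.* $\phi^0_u(x)=I(u\le x)$, $\phi^{j}_u(x)=\int_{(u,x]}\phi^{j-1}_v(x)\,d\mu(v)$; $\bar\phi_{\bar s(n+1)}(x)=\prod_{1\le j\le n,\,s_j\neq\emptyset}\phi^j_0(x(s_j\setminus s_{j+1}))$; $\mu^0(f)=f$, $\mu^j(f)(x)=\int_{(0,x]}\mu^{j-1}(f)\,d\mu$; and, for $s_{k+1}\neq\emptyset$, $\tilde Q^{(k)}_{\bar s(k+1)}(u)=\int_{(0(s_{k+1}),u]}Q^{(k)}_{\bar s(k+1)}(dy)$. *Statement.* Let $Q\in D^{(k)}([0,1]^d)$, and fix any family of derivatives (any choice of versions) as in the definition of the class. Then for every $\bar s(k+1)$ with $s_{k+1}\neq\emptyset$ the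 section $Q^{(k)}_{\bar s(k+1)}$ generates a unique finite signed measure $Q^{(k)}_{\bar s(k+1)}(du)$ on $(0,1]^{s_{k+1}}$, and for every $x\in[0,1]^d$ $$Q(x)=\sum_{\bar s(k+1)\in\mathcal S^{k+1}(d)}\bar\phi_{\bar s(k+1)}(x)\int_{(0(s_{k+1}),x(s_{k+1})]}\phi^k_u(x(s_{k+1}))\,Q^{(k)}_{\bar s(k+1)}(du),$$ the same holds with the integrals taken over all of $(0(s_{k+1}),1(s_{k+1})]$, and $$Q(x)=\sum_{\bar s(k+1)\in\mathcal S^{k+1}(d)}\bar\phi_{\bar s(k+1)}(x)\,\mu^k\big(\tilde Q^{(k)}_{\bar s(k+1)}\big)(x(s_{k+1})),$$ where, by convention, for $s_{k+1}=\emptyset$ both the integral and $\mu^k(\tilde Q^{(k)}_{\bar s(k+1)})$ stand for the constant $Q^{(m)}_{\bar s(m)}(0(s_m))$, $m=m(\bar s(k+1))$. Written out, $$Q(x)=\sum_{\bar s(k+1):\,s_{k+1}=\emptyset}\bar\phi_{\bar s(m+1)}(x)\,Q^{(m)}_{\bar s(m)}(0(s_m))+\sum_{\bar s(k+1):\,s_{k+1}\ne\emptyset}\bar\phi_{\bar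 s(k+1)}(x)\int_{(0,1]^{s_{k+1}}}\phi^k_u(x(s_{k+1}))\,Q^{(k)}_{\bar s(k+1)}(du),$$ and likewise with $\mu^k(\tilde Q^{(k)}_{\bar s(k+1)})(x(s_{k+1}))$ in place of the integral in the second sum. Moreover, the $L_1$-norm of the coefficients equals the $k$-th order sectional variation norm: $$\sum_{\bar s(k+1):\,s_{k+1}=\emptyset}\big|Q^{(m)}_{\bar s(m)}(0(s_m))\big|+\sum_{\bar s(k+1):\,s_{k+1}\ne\emptyset}\int_{(0,1]^{s_{k+1}}}\big|Q^{(k)}_{\bar s(k+1)}(du)\big|=\|Q\|^*_{v,k}.$$ -/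

import Mathlib

open MeasureTheory Filter Topology
open scoped ENNReal

namespace KSpline

noncomputable section

/-! ### Functions on a cube `[0,1]^ι`: boxes, differences, variation, generated measure -/

section Cube

variable {ι : Type*} [Fintype ι]

/-- The half-open box `(a, b] = ∏ᵢ (aᵢ, bᵢ]`. -/
def box (a b : ι → ℝ) : Set (ι → ℝ) := Set.univ.pi fun i => Set.Ioc (a i) (b i)

open Classical in
/-- The generalized difference of `f` across the corners of `(a, b]`:
`∑_T (-1)^|T| f(a on T, b off T)`. -/
def gdiff (f : (ι → ℝ) → ℝ) (a b : ι → ℝ) : ℝ :=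
  ∑ T : Finset ι, (-1) ^ T.card * f fun i => if i ∈ T then a i else b i

/-- `f` is cadlag on `[0,1]^ι`: at each point it has a limit along each of the quadrants (strictly
below in the coordinates of `T`, weakly above in the others) inside the cube, and the limit along
the upper right quadrant is the value of `f`. -/
def IsCadlag (f : (ι → ℝ) → ℝ) : Prop :=
  ∀ x ∈ Set.Icc (0 : ι → ℝ) 1, ∀ T : Set ι, ∃ l : ℝ,
    Tendsto f
      (𝓝[{y | y ∈ Set.Icc (0 : ι → ℝ) 1 ∧ ∀ i, (i ∈ T → y i < x i) ∧ (i ∉ T → x i ≤ y i)}] x)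
      (𝓝 l) ∧ (T = ∅ → l = f x)

/-- The box `(0,1]^ι`, in the form used for partitions into boxes. -/
def unitBox (ι : Type*) : BoxIntegral.Box ι where
  lower := 0
  upper := 1
  lower_lt_upper := fun _ => zero_lt_one

/-- The variation norm `‖f‖_v` of `f` over `(0,1]^ι`: the supremum, over finite families of
disjoint half-open sub-boxes, of the sum of the absolute generalized differences. -/
def varNorm (f : (ι → ℝ) → ℝ) : ℝ≥0∞ :=
  ⨆ π : BoxIntegral.Prepartition (unitBox ι),
    ∑ J ∈ π.boxes, ENNReal.ofReal |gdiff f J.lower J.upper|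

/-- `ν` is the signed measure on `(0,1]^ι` generated by `f`: it gives each box `(a, b]` the
generalized difference of `f`. -/
def IsGeneratedBy (ν : SignedMeasure (ι → ℝ)) (f : (ι → ℝ) → ℝ) : Prop :=
  (∀ a b : ι → ℝ, 0 ≤ a → a ≤ b → b ≤ 1 → ν (box a b) = gdiff f a b) ∧
    ∀ A : Set (ι → ℝ), MeasurableSet A → Disjoint A (box 0 1) → ν A = 0

lemma measurableSet_box (a b : ι → ℝ) : MeasurableSet (box a b) :=
  MeasurableSet.univ_pi fun _ => measurableSet_Ioc

/-- There is at most one signed measure generated by `f`. -/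
theorem IsGeneratedBy.unique {ν ν' : SignedMeasure (ι → ℝ)} {f : (ι → ℝ) → ℝ}
    (h : IsGeneratedBy ν f) (h' : IsGeneratedBy ν' f) : ν = ν' := by
  have key : ∀ {ρ : SignedMeasure (ι → ℝ)}, IsGeneratedBy ρ f → ∀ A, MeasurableSet A →
      ρ A = ρ (A ∩ box 0 1) := by
    intro ρ hρ A hA
    have h1 := VectorMeasure.of_union (v := ρ) (A := A ∩ box 0 1) (B := A \ box 0 1)
      (Set.disjoint_left.2 fun x hx hx' => hx'.2 hx.2)
      (hA.inter (measurableSet_box 0 1)) (hA.diff (measurableSet_box 0 1))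
    rw [Set.inter_union_sdiff, hρ.2 _ (hA.diff (measurableSet_box 0 1))
      Set.disjoint_sdiff_left, add_zero] at h1
    exact h1
  have hgen : (inferInstance : MeasurableSpace (ι → ℝ)) = MeasurableSpace.generateFrom
      (Set.pi Set.univ '' Set.pi Set.univ
        fun _ : ι => {S : Set ℝ | ∃ l u, l ≤ u ∧ Set.Ioc l u = S}) := by
    refine (generateFrom_eq_pi (fun i => ?_) (fun i => ?_)).symm
    · rw [BorelSpace.measurable_eq (α := ℝ), borel_eq_generateFrom_Ioc_le]
    · refine ⟨fun n : ℕ => Set.Ioc (-(n : ℝ)) n, fun n => ⟨_, _, by linarith [n.cast_nonneg (α := ℝ)], rfl⟩, ?_⟩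
      refine Set.eq_univ_of_forall fun x => Set.mem_iUnion.2 ?_
      obtain ⟨n, hn⟩ := exists_nat_gt |x|
      exact ⟨n, (abs_lt.1 hn).1, (abs_lt.1 hn).2.le⟩
  refine VectorMeasure.ext_of_generateFrom _ ?_ hgen (IsPiSystem.pi fun i => ?_) ?_
  · rintro _ ⟨S, hS, rfl⟩
    choose a b hab hS using fun i => hS i (Set.mem_univ i)
    have hSb : Set.pi Set.univ S = box a b := by
      simp only [box]
      congr 1
      ext1 i
      exact (hS i).symm
    rw [hSb, key h _ (measurableSet_box a b), key h' _ (measurableSet_box a b)]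
    have hinter : box a b ∩ box 0 1 = box (a ⊔ 0) (b ⊓ 1) := by
      simp only [box, ← Set.pi_inter_distrib, Set.Ioc_inter_Ioc]
      rfl
    rw [hinter]
    by_cases hle : a ⊔ 0 ≤ b ⊓ 1
    · rw [h.1 _ _ le_sup_right hle inf_le_right, h'.1 _ _ le_sup_right hle inf_le_right]
    · have : box (a ⊔ 0) (b ⊓ 1) = ∅ := by
        rw [Pi.le_def, not_forall] at hle
        obtain ⟨i, hi⟩ := hle
        exact Set.univ_pi_eq_empty (Set.Ioc_eq_empty fun hlt => hi hlt.le)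
      simp [this]
  · rintro _ ⟨a, b, -, rfl⟩ _ ⟨a', b', -, rfl⟩ hne
    rw [Set.Ioc_inter_Ioc] at hne ⊢
    exact ⟨_, _, (Set.nonempty_Ioc.1 hne).le, rfl⟩
  · rw [key h _ MeasurableSet.univ, key h' _ MeasurableSet.univ, Set.univ_inter,
      h.1 0 1 le_rfl zero_le_one le_rfl, h'.1 0 1 le_rfl zero_le_one le_rfl]

open Classical in
/-- The signed measure `df` on `(0,1]^ι` generated by `f` (`0` if there is none). -/
def dMeasure (f : (ι → ℝ) → ℝ) : SignedMeasure (ι → ℝ) :=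
  if h : ∃ ν, IsGeneratedBy ν f then h.choose else 0

/-- `g` is a version of the Radon-Nikodym derivative `df/dμ`: `g` is Lebesgue integrable on
`(0,1]^ι` and the measure generated by `f` is `g dμ`. -/
def IsRNDeriv (f g : (ι → ℝ) → ℝ) : Prop :=
  IntegrableOn g (box 0 1) ∧
    IsGeneratedBy ((volume.restrict (box (0 : ι → ℝ) 1)).withDensityᵥ g) f

open Classical in
/-- The `j`-th order spline `φ_u^j(x)`:
`φ_u^0(x) = I(u ≤ x)` and `φ_u^{j+1}(x) = ∫_{(u,x]} φ_v^j(x) dv`. -/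
def spline : ℕ → (ι → ℝ) → (ι → ℝ) → ℝ
  | 0, u, x => if u ≤ x then 1 else 0
  | j + 1, u, x => ∫ v in box u x, spline j v x

/-- The `j`-th order primitive `μ^j(f)`: `μ^0(f) = f` and `μ^{j+1}(f)(x) = ∫_{(0,x]} μ^j(f) dμ`. -/
def primitive : ℕ → ((ι → ℝ) → ℝ) → (ι → ℝ) → ℝ
  | 0, f, x => f x
  | j + 1, f, x => ∫ y in box 0 x, primitive j f y

end Cube

/-! ### Sections and nested chains of coordinate subsets -/

variable {d : ℕ}

/-- The subvector `x(s)`. -/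
def sub (s : Finset (Fin d)) (x : Fin d → ℝ) : s → ℝ := fun i => x i

/-- The vector `(x(s), 0(-s))`. -/
def zeroExt (s : Finset (Fin d)) (x : s → ℝ) : Fin d → ℝ :=
  fun i => if h : i ∈ s then x ⟨i, h⟩ else 0

/-- The section `x(s) ↦ F(x(s), 0(-s))`, a function on `[0,1]^s`. -/
def sect (s : Finset (Fin d)) (F : (Fin d → ℝ) → ℝ) : (s → ℝ) → ℝ := fun x => F (zeroExt s x)

open Classical in
/-- The set `S^n(d)` of vectors `(s_1, …, s_n)` with `s_n ⊆ … ⊆ s_1 ⊆ {1, …, d}`.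
The entry `s_j` is `s ⟨j - 1, _⟩`. -/
def chains (d n : ℕ) : Finset (Fin n → Finset (Fin d)) :=
  Finset.univ.filter fun s => Antitone s

/-- The initial segment `(s_1, …, s_m)` of `(s_1, …, s_n)` (used for `m ≤ n`). -/
def trunc {n : ℕ} (s : Fin n → Finset (Fin d)) (m : ℕ) : Fin m → Finset (Fin d) :=
  fun i => if h : (i : ℕ) < n then s ⟨i, h⟩ else ∅

/-- `m(s)`: the smallest `m` for which `s_{m+1}` is empty. It is only used when the last entry is
empty; it is `0` exactly when moreover `s_1` is empty. -/
def firstEmpty {n : ℕ} (s : Fin n → Finset (Fin d)) : ℕ :=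
  sInf {m | ∃ h : m < n, s ⟨m, h⟩ = ∅}

/-- The edge factor `φ̄_s(x) = ∏_{j ≤ n, s_j ≠ ∅} φ_0^j(x(s_j \ s_{j+1}))` of
`s = (s_1, …, s_{n+1})`. -/
def phiBar {n : ℕ} (s : Fin (n + 1) → Finset (Fin d)) (x : Fin d → ℝ) : ℝ :=
  ∏ j : Fin n with (s j.castSucc).Nonempty,
    spline (j + 1) 0 (sub (s j.castSucc \ s j.succ) x)

/-! ### Sequentially defined derivatives and the smoothness class -/

/-- A family of functions `Q^{(j)}_{(s_1, …, s_j)}`. The function `Q^{(j)}_{(s_1, …, s_j)}` of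
`x(s_j)` is recorded as a function of `x ∈ ℝ^d`, of which only the values at points
`(x(s_j), 0(-s_j))` matter. -/
abbrev Family (d : ℕ) : Type :=
  (j : ℕ) → (Fin j → Finset (Fin d)) → (Fin d → ℝ) → ℝ

/-- The section `Q^{(k)}_{(s_1, …, s_{k+1})}` of `Q^{(k)}_{(s_1, …, s_k)}`, a function on
`[0,1]^{s_{k+1}}`. -/
def topSect {k : ℕ} (q : Family d) (s : Fin (k + 1) → Finset (Fin d)) :
    (s (Fin.last k) → ℝ) → ℝ :=
  sect (s (Fin.last k)) (q k (trunc s k))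

/-- The constant `Q^{(m)}_{(s_1, …, s_m)}(0(s_m))`, `m = m(s)`, attached to a chain which reaches
the empty set. For `s_1 = ∅` it is `Q(0)`. -/
def constCoef {n : ℕ} (q : Family d) (s : Fin n → Finset (Fin d)) : ℝ :=
  q (firstEmpty s) (trunc s (firstEmpty s)) 0

/-- `q` is a family of (versions of) sequential derivatives up to order `k` which exhibits `Q` as
`k`-th order smooth: `Q^{(0)} = Q`; for nonempty `s_{j+1} ⊆ … ⊆ s_1`, `j < k`, the function
`Q^{(j+1)}_{(s_1, …, s_{j+1})}` is the Radon-Nikodym derivative of the `s_{j+1}`-section of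
`Q^{(j)}_{(s_1, …, s_j)}`; and the sections of the `k`-th order derivatives are cadlag with finite
variation norm. -/
structure IsDerivFamily (k : ℕ) (Q : (Fin d → ℝ) → ℝ) (q : Family d) : Prop where
  zero : ∀ s, ∀ x ∈ Set.Icc (0 : Fin d → ℝ) 1, q 0 s x = Q x
  deriv : ∀ j < k, ∀ s ∈ chains d (j + 1), (s (Fin.last j)).Nonempty →
    IsRNDeriv (sect (s (Fin.last j)) (q j (trunc s j))) (sect (s (Fin.last j)) (q (j + 1) s))
  cadlag : ∀ s ∈ chains d (k + 1), (s (Fin.last k)).Nonempty → IsCadlag (topSect q s)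
  finite : ∀ s ∈ chains d (k + 1), (s (Fin.last k)).Nonempty → varNorm (topSect q s) < ∞

/-- The `k`-th order smoothness class `D^{(k)}([0,1]^d)` (only the values of `Q` on the cube
matter). -/
def smoothClass (d k : ℕ) : Set ((Fin d → ℝ) → ℝ) := {Q | ∃ q, IsDerivFamily k Q q}

open Classical in
/-- The `k`-th order sectional variation norm `∑_s ‖Q^{(k)}_s‖_v`, where the variation norm of a
constant is its absolute value. -/
def sectVarNorm (k : ℕ) (q : Family d) : ℝ≥0∞ :=
  ∑ s ∈ chains d (k + 1),
    if s (Fin.last k) = ∅ then ENNReal.ofReal |constCoef q s| else varNorm (topSect q s)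

/-- `Q̃^{(k)}_s(u) = ∫_{(0,u]} Q^{(k)}_s(dy)`. -/
def tildeQ {k : ℕ} (q : Family d) (s : Fin (k + 1) → Finset (Fin d)) :
    (s (Fin.last k) → ℝ) → ℝ :=
  fun u => dMeasure (topSect q s) (box 0 u)

open Classical in
/-- `μ^k(Q̃^{(k)}_s)` as a function of `x`, with the convention that it is the constant
`Q^{(m)}_{(s_1, …, s_m)}(0(s_m))` if `s_{k+1}` is empty. -/
def primPart {k : ℕ} (q : Family d) (s : Fin (k + 1) → Finset (Fin d)) (x : Fin d → ℝ) : ℝ :=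
  if s (Fin.last k) = ∅ then constCoef q s
  else primitive k (tildeQ q s) (sub (s (Fin.last k)) x)

/-- `∫_B φ_u^k(x(s_{k+1})) Q^{(k)}_s(du)`. -/
def splineInt {k : ℕ} (q : Family d) (s : Fin (k + 1) → Finset (Fin d))
    (B : Set (s (Fin.last k) → ℝ)) (x : Fin d → ℝ) : ℝ :=
  ∫ᵛ u in B, spline k u (sub (s (Fin.last k)) x) ∂•(dMeasure (topSect q s))

open Classical in
/-- `∫_B φ_u^k(x(s_{k+1})) Q^{(k)}_s(du)`, with the convention that it is the constant
`Q^{(m)}_{(s_1, …, s_m)}(0(s_m))` if `s_{k+1}` is empty. -/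
def splinePart {k : ℕ} (q : Family d) (s : Fin (k + 1) → Finset (Fin d))
    (B : Set (s (Fin.last k) → ℝ)) (x : Fin d → ℝ) : ℝ :=
  if s (Fin.last k) = ∅ then constCoef q s else splineInt q s B x

end

end KSpline

open KSpline

/-!
A function on a face of the cube is the sum, over the subfaces, of the generalized differences of
its sections over `(0, u]`, and a Radon–Nikodym derivative turns such a difference into the
integral of the next derivative. Alternating the two identities, and using that the primitive of a
product of functions of complementary coordinates is the product of their primitives, every step
extends the chain `s₁ ⊇ s₂ ⊇ …` by one set `t ⊆ S` and contributes the factor of `phiBar` that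
belongs to `S \ t`.

At top order the derivative of the section is replaced by the measure it generates. That measure
exists because the positive and negative parts of the cell differences on a grid, placed at the
lower corners of the cells, have masses bounded by the variation, hence weak limits along an
ultrafilter of grids. The difference of the two limits has the right value on boxes with null
frontier, and then on all boxes by right-continuity. Its total mass is at most the variation, which
is the nontrivial half of the norm identity.

Finally, Fubini's theorem identifies the `k`-th order primitive of the distribution function of a
measure with the integral of the splines `φᵏ_u(x)` against it.
-/

namespace KSpline

section PointFunctionals

variable {X Y : Type*}

/-- The finite linear combinations of point evaluations, as functionals of functions `X → ℝ`. -/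
def pointFunctionals (X : Type*) : Submodule ℝ ((X → ℝ) → ℝ) :=
  Submodule.span ℝ (Set.range fun x f => f x)

lemma eval_mem_pointFunctionals (x : X) : (fun f => f x) ∈ pointFunctionals X :=
  Submodule.subset_span ⟨x, rfl⟩

lemma sum_mem_pointFunctionals {κ : Type*} (s : Finset κ) {L : κ → (X → ℝ) → ℝ}
    (h : ∀ k ∈ s, L k ∈ pointFunctionals X) : (fun f => ∑ k ∈ s, L k f) ∈ pointFunctionals X := by
  simpa only [Finset.sum_fn] using Submodule.sum_mem _ h

lemma comp_mem_pointFunctionals (φ : Y → X) {L : (Y → ℝ) → ℝ} (h : L ∈ pointFunctionals Y) :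
    (fun f => L (f ∘ φ)) ∈ pointFunctionals X := by
  induction h using Submodule.span_induction with
  | mem L hL =>
    obtain ⟨y, rfl⟩ := hL
    exact eval_mem_pointFunctionals (φ y)
  | zero => exact Submodule.zero_mem _
  | add L L' _ _ hL hL' => exact Submodule.add_mem _ hL hL'
  | smul c L _ hL => exact Submodule.smul_mem _ c hL

variable {ι : Type*} [Fintype ι]

-- Indicators of points are product functions, and they separate the point functionals.
lemma eq_of_forall_prod_eq {L L' : ((ι → ℝ) → ℝ) → ℝ} (hL : L ∈ pointFunctionals (ι → ℝ))
    (hL' : L' ∈ pointFunctionals (ι → ℝ))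
    (hprod : ∀ g : ι → ℝ → ℝ, (L fun x => ∏ i, g i (x i)) = L' fun x => ∏ i, g i (x i)) :
    L = L' := by
  classical
  obtain ⟨c, hc⟩ := (Finsupp.mem_span_range_iff_exists_finsupp).1 (Submodule.sub_mem _ hL hL')
  have hsum (f : (ι → ℝ) → ℝ) : L f - L' f = c.sum fun p r => r * f p := by
    rw [← Pi.sub_apply, ← hc, Finsupp.sum, Finset.sum_apply]
    rfl
  have hc0 : c = 0 := by
    ext p
    have hdelta (x : ι → ℝ) : (∏ i, if x i = p i then (1 : ℝ) else 0) = if x = p then 1 else 0 := by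
      simp [Finset.prod_ite_zero, funext_iff]
    have hp := hsum fun x => ∏ i, if x i = p i then 1 else 0
    rw [hprod fun i t => if t = p i then 1 else 0, sub_self] at hp
    simpa [hdelta, Finsupp.sum] using hp.symm
  funext f
  simpa [hc0, sub_eq_zero] using hsum f

end PointFunctionals

section Differences

variable {ι : Type*} [Fintype ι]

lemma gdiff_eq_sum_piecewise [DecidableEq ι] (f : (ι → ℝ) → ℝ) (a b : ι → ℝ) :
    gdiff f a b = ∑ T : Finset ι, (-1) ^ T.card * f (T.piecewise a b) := by
  unfold gdiff Finset.piecewise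
  congr! 5

lemma gdiff_prod (g : ι → ℝ → ℝ) (a b : ι → ℝ) :
    gdiff (fun x => ∏ i, g i (x i)) a b = ∏ i, (g i (b i) - g i (a i)) := by
  classical
  rw [gdiff_eq_sum_piecewise, Finset.prod_sub, Finset.powerset_univ]
  refine Finset.sum_congr rfl fun T _ => ?_
  rw [← Finset.prod_sdiff (Finset.subset_univ T), mul_assoc]
  congr 2 <;> refine Finset.prod_congr rfl fun i hi => ?_
  · rw [Finset.piecewise_eq_of_notMem _ _ _ (Finset.mem_sdiff.1 hi).2]
  · rw [Finset.piecewise_eq_of_mem _ _ _ hi]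

lemma gdiff_const_mul (c : ℝ) (f : (ι → ℝ) → ℝ) (a b : ι → ℝ) :
    gdiff (fun x => c * f x) a b = c * gdiff f a b := by
  simp only [gdiff, Finset.mul_sum, mul_left_comm c]

lemma gdiff_neg (f : (ι → ℝ) → ℝ) (a b : ι → ℝ) : gdiff (-f) a b = -gdiff f a b := by
  simp only [gdiff, Pi.neg_apply, mul_neg, Finset.sum_neg_distrib]

lemma gdiff_mem_pointFunctionals (a b : ι → ℝ) :
    (fun f => gdiff f a b) ∈ pointFunctionals (ι → ℝ) :=
  sum_mem_pointFunctionals _ fun _ _ => Submodule.smul_mem _ _ (eval_mem_pointFunctionals _)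

lemma sum_Ico_int_telescope (g : ℤ → ℝ) {l m : ℤ} (hlm : l ≤ m) :
    ∑ j ∈ Finset.Ico l m, (g (j + 1) - g j) = g m - g l := by
  induction m, hlm using Int.leInduction with
  | base => simp
  | succ m hlm ih =>
    rw [← Finset.insert_Ico_right_eq_Ico_add_one hlm,
      Finset.sum_insert Finset.right_notMem_Ico, ih, sub_add_sub_cancel]

lemma sum_gdiff_grid [DecidableEq ι] (f : (ι → ℝ) → ℝ) (u : ℤ → ℝ) {l m : ι → ℤ} (hlm : l ≤ m) :
    ∑ ν ∈ Fintype.piFinset fun i => Finset.Ico (l i) (m i),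
      gdiff f (fun i => u (ν i)) (fun i => u (ν i + 1)) =
      gdiff f (fun i => u (l i)) (fun i => u (m i)) := by
  refine congrFun (eq_of_forall_prod_eq
    (sum_mem_pointFunctionals _ fun ν _ => gdiff_mem_pointFunctionals _ _)
    (gdiff_mem_pointFunctionals _ _) fun g => ?_) f
  simp only [gdiff_prod]
  rw [← Finset.prod_univ_sum (fun i => Finset.Ico (l i) (m i))
    fun i j => g i (u (j + 1)) - g i (u j)]
  exact Finset.prod_congr rfl fun i _ => sum_Ico_int_telescope (fun j => g i (u j)) (hlm i)

end Differences

section Faces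

variable {d : ℕ}

lemma sect_prod (g : Fin d → ℝ → ℝ) (t : Finset (Fin d)) :
    sect t (fun x => ∏ i, g i (x i)) =
      fun w => (∏ i ∈ tᶜ, g i 0) * ∏ i : t, g i (w i) := by
  funext w
  rw [sect, ← Finset.prod_compl_mul_prod t, ← Finset.prod_coe_sort t]
  congr 1
  · exact Finset.prod_congr rfl fun i hi => by rw [zeroExt, dif_neg (Finset.mem_compl.1 hi)]
  · exact Finset.prod_congr rfl fun i _ => by rw [zeroExt, dif_pos i.2]

lemma gdiff_sect_prod (g : Fin d → ℝ → ℝ) (t : Finset (Fin d)) (z : Fin d → ℝ) :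
    gdiff (sect t fun x => ∏ i, g i (x i)) 0 (sub t z) =
      (∏ i ∈ tᶜ, g i 0) * ∏ i ∈ t, (g i (z i) - g i 0) := by
  rw [sect_prod, gdiff_const_mul, gdiff_prod fun (i : t) => g i, ← Finset.prod_coe_sort t]
  rfl

-- On a product function this is the expansion of `∏ i ∈ s, ((g i (y i) - g i 0) + g i 0)`.
lemma sect_eq_sum_gdiff (F : (Fin d → ℝ) → ℝ) (s : Finset (Fin d)) (y : s → ℝ) :
    sect s F y = ∑ t ∈ s.powerset, gdiff (sect t F) 0 (sub t (zeroExt s y)) := by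
  refine congrFun (eq_of_forall_prod_eq (eval_mem_pointFunctionals (zeroExt s y))
    (sum_mem_pointFunctionals _ fun t _ =>
      comp_mem_pointFunctionals (zeroExt t) (gdiff_mem_pointFunctionals _ _)) fun g => ?_) F
  change sect s (fun x => ∏ i, g i (x i)) y =
    ∑ t ∈ s.powerset, gdiff (sect t fun x => ∏ i, g i (x i)) 0 (sub t (zeroExt s y))
  set z := zeroExt s y with hz
  have hy : ∏ i : s, g i (y i) = ∏ i ∈ s, ((g i (z i) - g i 0) + g i 0) := by
    rw [← Finset.prod_coe_sort s]
    exact Finset.prod_congr rfl fun i _ => by simp [hz, zeroExt]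
  rw [congrFun (sect_prod g s) y, hy, Finset.prod_add, Finset.mul_sum]
  refine Finset.sum_congr rfl fun t ht => ?_
  rw [gdiff_sect_prod, ← Finset.prod_sdiff (Finset.compl_subset_compl.2 (Finset.mem_powerset.1 ht)),
    compl_sdiff_compl]
  ring

end Faces

section Portmanteau

variable {Ω κ : Type*} [MeasurableSpace Ω] [TopologicalSpace Ω] {L : Filter κ}

lemma measureReal_closure_of_null_frontier {μ : Measure Ω} {E : Set Ω} (hE : μ (frontier E) = 0) :
    μ.real (closure E) = μ.real E := by
  simp only [Measure.real, measure_closure_of_null_frontier hE]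

variable [OpensMeasurableSpace Ω] {μs : κ → FiniteMeasure Ω} {μ : FiniteMeasure Ω}

lemma tendsto_measureReal_univ (h : Tendsto μs L (𝓝 μ)) :
    Tendsto (fun i => (μs i : Measure Ω).real Set.univ) L (𝓝 ((μ : Measure Ω).real Set.univ)) :=
  NNReal.tendsto_coe.2 ((FiniteMeasure.continuous_mass.tendsto μ).comp h)

lemma measure_univ_add_le_of_tendsto [L.NeBot] {νs : κ → FiniteMeasure Ω} {ν : FiniteMeasure Ω}
    (hμ : Tendsto μs L (𝓝 μ)) (hν : Tendsto νs L (𝓝 ν)) {C : ℝ≥0∞}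
    (hC : ∀ i, (μs i : Measure Ω) Set.univ + (νs i : Measure Ω) Set.univ ≤ C) :
    (μ : Measure Ω) Set.univ + (ν : Measure Ω) Set.univ ≤ C := by
  simp only [← FiniteMeasure.ennreal_mass] at hC ⊢
  have hmass_μ := (FiniteMeasure.continuous_mass.tendsto μ).comp hμ
  have hmass_ν := (FiniteMeasure.continuous_mass.tendsto ν).comp hν
  exact le_of_tendsto ((ENNReal.tendsto_coe.2 hmass_μ).add (ENNReal.tendsto_coe.2 hmass_ν))
    (Eventually.of_forall hC)

variable [HasOuterApproxClosed Ω]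

lemma eventually_measureReal_lt (h : Tendsto μs L (𝓝 μ)) {E : Set Ω} {r : ℝ}
    (hr : (μ : Measure Ω).real (closure E) < r) : ∀ᶠ i in L, (μs i : Measure Ω).real E < r := by
  have hlimsup := FiniteMeasure.limsup_measure_closed_le_of_tendsto h (isClosed_closure (s := E))
  have hr' := (ENNReal.lt_ofReal_iff_toReal_lt (measure_ne_top _ _)).2 hr
  filter_upwards [eventually_lt_of_limsup_lt (hlimsup.trans_lt hr')] with i hi
  exact (measureReal_mono subset_closure).trans_lt
    ((ENNReal.lt_ofReal_iff_toReal_lt (measure_ne_top _ _)).1 hi)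

lemma tendsto_measureReal_of_null_frontier (h : Tendsto μs L (𝓝 μ)) {E : Set Ω}
    (hmeas : MeasurableSet E) (hE : (μ : Measure Ω) (frontier E) = 0) :
    Tendsto (fun i => (μs i : Measure Ω).real E) L (𝓝 ((μ : Measure Ω).real E)) := by
  refine tendsto_order.2 ⟨fun r hr => ?_, fun r hr => ?_⟩
  · set δ := ((μ : Measure Ω).real E - r) / 2 with hδ
    have hδ_pos : 0 < δ := half_pos (sub_pos.2 hr)
    have hclosure := measureReal_closure_of_null_frontier ((frontier_compl E).symm ▸ hE)
    have hcompl := eventually_measureReal_lt h (E := Eᶜ)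
      (r := (μ : Measure Ω).real Eᶜ + δ) (by linarith)
    have hmass := (tendsto_order.1 (tendsto_measureReal_univ h)).1
      ((μ : Measure Ω).real Set.univ - δ) (by linarith)
    filter_upwards [hcompl, hmass] with i hcompl_i hmass_i
    rw [measureReal_compl hmeas, measureReal_compl hmeas] at hcompl_i
    linarith
  · exact eventually_measureReal_lt h ((measureReal_closure_of_null_frontier hE).trans_lt hr)

end Portmanteau

section Boxes

variable {ι : Type*}

lemma box_mono {a a' b b' : ι → ℝ} (ha : a' ≤ a) (hb : b ≤ b') : box a b ⊆ box a' b' :=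
  Set.pi_mono fun i _ => Set.Ioc_subset_Ioc (ha i) (hb i)

lemma box_subset_Icc (a b : ι → ℝ) : box a b ⊆ Set.Icc a b :=
  fun _ hy => ⟨fun i => (hy i trivial).1.le, fun i => (hy i trivial).2⟩

instance isFiniteMeasure_volume_restrict_box [Fintype ι] (a b : ι → ℝ) :
    IsFiniteMeasure (volume.restrict (box a b)) :=
  isFiniteMeasure_restrict.2
    (measure_ne_top_of_subset (box_subset_Icc a b) isCompact_Icc.measure_lt_top.ne)

variable [Finite ι]

lemma frontier_box_subset (a b : ι → ℝ) :
    frontier (box a b) ⊆ ⋃ i, ({y | y i = a i} ∪ {y | y i = b i}) := by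
  rintro y ⟨hclosure, hinterior⟩
  by_contra hy
  simp only [Set.mem_iUnion, Set.mem_union, Set.mem_ofPred_eq, not_exists, not_or] at hy
  have hIcc : y ∈ Set.univ.pi fun i => Set.Icc (a i) (b i) :=
    closure_minimal (Set.pi_mono fun i _ => Set.Ioc_subset_Icc_self)
      (isClosed_set_pi fun i _ => isClosed_Icc) hclosure
  refine hinterior (interior_maximal (Set.pi_mono fun i _ => Set.Ioo_subset_Ioc_self)
    (isOpen_set_pi Set.finite_univ fun i _ => isOpen_Ioo) fun i hi => ?_)
  exact ⟨(hIcc i hi).1.lt_of_ne (Ne.symm (hy i).1), (hIcc i hi).2.lt_of_ne (hy i).2⟩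

-- Only countably many parallel hyperplanes can carry mass.
lemma exists_seq_null_frontier_box (μ : Measure (ι → ℝ)) [IsFiniteMeasure μ] (a b : ι → ℝ) :
    ∃ t : ℕ → ℝ, (∀ n, 0 < t n) ∧ Tendsto t atTop (𝓝 0) ∧
      ∀ n, μ (frontier (box (fun i => a i + t n) fun i => b i + t n)) = 0 := by
  cases nonempty_fintype ι
  have hcountable (c : ι → ℝ) : (⋃ i, {t : ℝ | 0 < μ {y | y i - c i = t}}).Countable :=
    Set.countable_iUnion fun i => Measure.countable_meas_level_set_pos (by fun_prop)
  have hdense := ((hcountable a).union (hcountable b)).dense_compl ℝ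
  choose t ht ht_pos ht_lt using fun n : ℕ =>
    hdense.exists_between (Nat.one_div_pos_of_nat (α := ℝ) (n := n))
  refine ⟨t, ht_pos, ?_, fun n => measure_mono_null (frontier_box_subset _ _)
    (measure_iUnion_null fun i => measure_union_null ?_ ?_)⟩
  · exact squeeze_zero (fun n => (ht_pos n).le) (fun n => (ht_lt n).le)
      tendsto_one_div_add_atTop_nhds_zero_nat
  all_goals
    have hnull := ht n
    simp only [Set.mem_compl_iff, Set.mem_union, Set.mem_iUnion, Set.mem_ofPred_eq, not_or,
      not_exists, not_lt, nonpos_iff_eq_zero, sub_eq_iff_eq_add'] at hnull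
  exacts [hnull.1 i, hnull.2 i]

lemma tendsto_measureReal_box_add (μ : Measure (ι → ℝ)) [IsFiniteMeasure μ] (a b : ι → ℝ)
    {t : ℕ → ℝ} (ht_pos : ∀ n, 0 < t n) (ht : Tendsto t atTop (𝓝 0)) :
    Tendsto (fun n => μ.real (box (fun i => a i + t n) fun i => b i + t n)) atTop
      (𝓝 (μ.real (box a b))) := by
  cases nonempty_fintype ι
  refine (ENNReal.tendsto_toReal (measure_ne_top _ _)).comp
    (tendsto_measure_of_tendsto_indicator_of_isFiniteMeasure _ μ
      (fun n => measurableSet_box _ _) fun y => ?_)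
  have hcoord (i : ι) : ∀ᶠ n in atTop,
      (a i + t n < y i ∧ y i ≤ b i + t n ↔ a i < y i ∧ y i ≤ b i) := by
    have hlim (c : ℝ) : Tendsto (fun n => c + t n) atTop (𝓝 c) := by
      simpa using tendsto_const_nhds.add ht
    have hlower : ∀ᶠ n in atTop, (a i + t n < y i ↔ a i < y i) := by
      rcases lt_or_ge (a i) (y i) with h | h
      · filter_upwards [(hlim (a i)).eventually_lt_const h] with n hn using iff_of_true hn h
      · exact Eventually.of_forall fun n => iff_of_false (by linarith [ht_pos n]) h.not_gt
    have hupper : ∀ᶠ n in atTop, (y i ≤ b i + t n ↔ y i ≤ b i) := by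
      rcases le_or_gt (y i) (b i) with h | h
      · exact Eventually.of_forall fun n => iff_of_true (by linarith [ht_pos n]) h
      · filter_upwards [(hlim (b i)).eventually_lt_const h] with n hn
          using iff_of_false hn.not_ge h.not_ge
    filter_upwards [hlower, hupper] with n h h' using and_congr h h'
  filter_upwards [eventually_all.2 hcoord] with n hn
  simp only [box, Set.mem_univ_pi, Set.mem_Ioc, hn]

end Boxes

section RightContinuity

variable {ι : Type*}

lemma IsCadlag.tendsto_right {f : (ι → ℝ) → ℝ} (hf : IsCadlag f) {x : ι → ℝ}
    (hx : x ∈ Set.Icc (0 : ι → ℝ) 1) : Tendsto f (𝓝[Set.Icc x 1] x) (𝓝 (f x)) := by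
  obtain ⟨l, hl, hlx⟩ := hf x hx ∅
  rw [hlx rfl] at hl
  refine hl.mono_left (nhdsWithin_mono _ fun y hy => ?_)
  exact ⟨⟨hx.1.trans hy.1, hy.2⟩, fun i => ⟨fun h => h.elim, fun _ => hy.1 i⟩⟩

lemma IsCadlag.tendsto_gdiff [Fintype ι] {f : (ι → ℝ) → ℝ} (hf : IsCadlag f) {κ : Type*}
    {L : Filter κ} {a b : ι → ℝ} (ha : a ∈ Set.Icc (0 : ι → ℝ) 1) (hb : b ∈ Set.Icc (0 : ι → ℝ) 1)
    {u v : κ → ι → ℝ} (hu : ∀ n, u n ∈ Set.Icc a 1) (hv : ∀ n, v n ∈ Set.Icc b 1)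
    (hua : Tendsto u L (𝓝 a)) (hvb : Tendsto v L (𝓝 b)) :
    Tendsto (fun n => gdiff f (u n) (v n)) L (𝓝 (gdiff f a b)) := by
  classical
  simp only [gdiff_eq_sum_piecewise]
  refine tendsto_finsetSum _ fun T _ => Tendsto.const_mul _ ?_
  refine (hf.tendsto_right (T.piecewise_mem_Icc_of_mem_of_mem ha hb)).comp
    (tendsto_nhdsWithin_iff.2 ⟨tendsto_pi_nhds.2 fun i => ?_, Eventually.of_forall fun n => ?_⟩)
  · by_cases hi : i ∈ T
    · simpa [hi] using tendsto_pi_nhds.1 hua i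
    · simpa [hi] using tendsto_pi_nhds.1 hvb i
  · exact ⟨T.piecewise_le_piecewise (hu n).1 (hv n).1,
      T.piecewise_le_of_le_of_le (hu n).2 (hv n).2⟩

end RightContinuity

section CellMeasure

variable {ι : Type*} [Fintype ι]

/-- The measure which puts the positive part of the difference of `f` over each cell of `π` on the
lower corner of the cell. With the mass on the lower corners, the cells whose corner lies in a box
are those with a coordinate in a half-open interval of indices. -/
noncomputable def cellMeasure (f : (ι → ℝ) → ℝ) (π : BoxIntegral.Prepartition (unitBox ι)) :
    Measure (ι → ℝ) :=
  ∑ J ∈ π.boxes, ENNReal.ofReal (gdiff f J.lower J.upper) • Measure.dirac J.lower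

variable (f : (ι → ℝ) → ℝ) (π : BoxIntegral.Prepartition (unitBox ι))

lemma cellMeasure_apply {A : Set (ι → ℝ)} (hA : MeasurableSet A) :
    cellMeasure f π A =
      ∑ J ∈ π.boxes, ENNReal.ofReal (gdiff f J.lower J.upper) * A.indicator 1 J.lower := by
  simp [cellMeasure, Measure.finsetSum_apply, Measure.dirac_apply' _ hA]

instance isFiniteMeasure_cellMeasure : IsFiniteMeasure (cellMeasure f π) :=
  ⟨by simp [cellMeasure_apply f π MeasurableSet.univ, ENNReal.sum_lt_top]⟩

lemma cellMeasure_compl_Icc : cellMeasure f π (Set.Icc 0 1)ᶜ = 0 := by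
  rw [cellMeasure_apply f π measurableSet_Icc.compl]
  refine Finset.sum_eq_zero fun J hJ => ?_
  have hJ_bounds := BoxIntegral.Box.le_iff_bounds.1 (π.le_of_mem hJ)
  have hlower : J.lower ∈ Set.Icc (0 : ι → ℝ) 1 :=
    ⟨hJ_bounds.1, fun i => (J.lower_lt_upper i).le.trans (hJ_bounds.2 i)⟩
  rw [Set.indicator_of_notMem (Set.notMem_compl_iff.2 hlower), mul_zero]

lemma cellMeasure_univ_add_neg_le :
    cellMeasure f π Set.univ + cellMeasure (-f) π Set.univ ≤ varNorm f := by
  refine le_trans (le_of_eq ?_) (le_iSup _ π)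
  rw [cellMeasure_apply f π MeasurableSet.univ, cellMeasure_apply (-f) π MeasurableSet.univ,
    ← Finset.sum_add_distrib]
  refine Finset.sum_congr rfl fun J _ => ?_
  rcases le_total 0 (gdiff f J.lower J.upper) with h | h
  · simp [gdiff_neg, h, abs_of_nonneg]
  · simp [gdiff_neg, h, abs_of_nonpos]

lemma cellMeasure_real_sub_neg {A : Set (ι → ℝ)} (hA : MeasurableSet A) :
    (cellMeasure f π).real A - (cellMeasure (-f) π).real A =
      ∑ J ∈ π.boxes, A.indicator (fun _ => gdiff f J.lower J.upper) J.lower := by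
  have hreal (g : (ι → ℝ) → ℝ) : (cellMeasure g π).real A =
      ∑ J ∈ π.boxes, A.indicator (fun _ => max (gdiff g J.lower J.upper) 0) J.lower := by
    rw [Measure.real, cellMeasure_apply g π hA, ENNReal.toReal_sum fun J _ => ?_]
    · refine Finset.sum_congr rfl fun J _ => ?_
      by_cases hJ : J.lower ∈ A <;> simp [hJ, ENNReal.toReal_ofReal']
    · by_cases hJ : J.lower ∈ A <;> simp [hJ]
  rw [hreal, hreal, ← Finset.sum_sub_distrib]
  refine Finset.sum_congr rfl fun J _ => ?_
  by_cases hJ : J.lower ∈ A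
  · simp only [Set.indicator_of_mem hJ, gdiff_neg, max_zero_sub_max_neg_zero_eq_self]
  · simp only [Set.indicator_of_notMem hJ, sub_self]

end CellMeasure

section Grid

open BoxIntegral

variable {ι : Type*} [Fintype ι]

/-- The least index `j ≤ n` with `t < j / n`, or `n` if there is none. -/
noncomputable def gridIndex (n : ℕ) (t : ℝ) : ℤ := min (⌊n * t⌋ + 1) n

lemma gridIndex_div_le_one (n : ℕ) (t : ℝ) : (gridIndex n t / n : ℝ) ≤ 1 :=
  div_le_one_of_le₀ (by exact_mod_cast min_le_right _ _) n.cast_nonneg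

lemma gridIndex_mono (n : ℕ) : Monotone (gridIndex n) := fun _ _ h =>
  min_le_min_right _ (by gcongr)

variable (n : ℕ) [NeZero n]

lemma mem_Icc_gridIndex_div (t : ℝ) :
    (gridIndex n t / n : ℝ) ∈ Set.Icc (min t 1) (min t 1 + 1 / n) := by
  have hn : (0 : ℝ) < n := Nat.cast_pos.2 (NeZero.pos n)
  have hfloor := Int.floor_le (n * t)
  have hlt := Int.lt_floor_add_one (n * t)
  simp only [gridIndex, Int.cast_min, Int.cast_add, Int.cast_one, Int.cast_natCast, Set.mem_Icc,
    le_div_iff₀ hn, div_le_iff₀ hn, add_mul, one_div_mul_cancel hn.ne']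
  rcases le_total t 1 with ht | ht
  · rw [min_eq_left ht]
    exact ⟨le_min (by linarith) (by nlinarith), (min_le_left _ _).trans (by linarith)⟩
  · rw [min_eq_right ht]
    exact ⟨le_min (by nlinarith) (by linarith), (min_le_right _ _).trans (by linarith)⟩

lemma tendsto_gridIndex_div (t : ℝ) :
    Tendsto (fun n : ℕ => (gridIndex (n + 1) t / (n + 1 : ℕ) : ℝ)) atTop (𝓝 (min t 1)) := by
  refine tendsto_of_tendsto_of_tendsto_of_le_of_le (h := fun n : ℕ => min t 1 + 1 / (n + 1 : ℕ))
    tendsto_const_nhds ?_ (fun n => (mem_Icc_gridIndex_div (n + 1) t).1)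
    fun n => (mem_Icc_gridIndex_div (n + 1) t).2
  simpa using tendsto_const_nhds.add (tendsto_one_div_add_atTop_nhds_zero_nat (𝕜 := ℝ))

lemma filter_admissibleIndex_lower_mem_box [DecidableEq ι] {a : ι → ℝ} (ha : 0 ≤ a) (b : ι → ℝ)
    [DecidablePred fun ν : ι → ℤ => (unitPartition.box n ν).lower ∈ box a b] :
    {ν ∈ unitPartition.admissibleIndex n (unitBox ι) | (unitPartition.box n ν).lower ∈ box a b} =
      Fintype.piFinset fun i => Finset.Ico (gridIndex n (a i)) (gridIndex n (b i)) := by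
  have hn : (0 : ℝ) < n := Nat.cast_pos.2 (NeZero.pos n)
  ext ν
  simp only [Finset.mem_filter, unitPartition.mem_admissibleIndex_iff, Box.le_iff_bounds,
    unitBox, unitPartition.box_lower, unitPartition.box_upper, box, Set.mem_univ_pi, Set.mem_Ioc,
    Pi.le_def, Pi.zero_apply, Pi.one_apply, ← forall_and, Fintype.mem_piFinset, Finset.mem_Ico,
    gridIndex]
  refine forall_congr' fun i => ?_
  have hcell : ((ν i : ℝ) + 1) / n ≤ 1 ↔ ν i + 1 ≤ n := by
    rw [div_le_one hn]; exact_mod_cast Iff.rfl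
  have hlower : a i < ν i / n ↔ ⌊n * a i⌋ < ν i := by
    rw [lt_div_iff₀ hn, Int.floor_lt, mul_comm]
  have hupper : (ν i / n : ℝ) ≤ b i ↔ ν i ≤ ⌊n * b i⌋ := by
    rw [div_le_iff₀ hn, Int.le_floor, mul_comm]
  have hnonneg : (0 : ℝ) ≤ ν i / n ↔ 0 ≤ ν i := by
    rw [le_div_iff₀ hn, zero_mul]; exact_mod_cast Iff.rfl
  have hfloor : 0 ≤ ⌊n * a i⌋ := Int.floor_nonneg.2 (mul_nonneg hn.le (ha i))
  rw [hcell, hlower, hupper, hnonneg]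
  omega

/-- `cellMeasure` for the partition of the unit cube into cells of side `1 / (n + 1)`. -/
noncomputable def gridMeasure (f : (ι → ℝ) → ℝ) (n : ℕ) : FiniteMeasure (ι → ℝ) :=
  ⟨cellMeasure f (unitPartition.prepartition (n + 1) (unitBox ι)).toPrepartition, inferInstance⟩

lemma gridMeasure_real_box_sub_neg (f : (ι → ℝ) → ℝ) (n : ℕ) {a b : ι → ℝ} (ha : 0 ≤ a)
    (hab : a ≤ b) :
    (gridMeasure f n : Measure (ι → ℝ)).real (box a b) -
        (gridMeasure (-f) n : Measure (ι → ℝ)).real (box a b) =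
      gdiff f (fun i => gridIndex (n + 1) (a i) / (n + 1 : ℕ))
        fun i => gridIndex (n + 1) (b i) / (n + 1 : ℕ) := by
  classical
  simp only [gridMeasure, FiniteMeasure.toMeasure_mk]
  rw [cellMeasure_real_sub_neg _ _ (measurableSet_box a b)]
  simp only [unitPartition.prepartition]
  rw [Finset.sum_image fun ν _ ν' _ h => unitPartition.box_injective (n + 1) h]
  simp only [Set.indicator_apply]
  rw [← Finset.sum_filter, filter_admissibleIndex_lower_mem_box (n + 1) ha b,
    ← sum_gdiff_grid f (fun j => j / (n + 1 : ℕ)) fun i => gridIndex_mono (n + 1) (hab i)]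
  simp

end Grid

section Existence

variable {ι : Type*} [Fintype ι] {f : (ι → ℝ) → ℝ}

lemma varNorm_neg (f : (ι → ℝ) → ℝ) : varNorm (-f) = varNorm f := by
  simp only [varNorm, gdiff_neg, abs_neg]

lemma exists_tendsto_gridMeasure (hv : varNorm f < ∞) :
    ∃ P, Tendsto (gridMeasure f) (hyperfilter ℕ) (𝓝 P) := by
  have hcompact := isCompact_setOfPred_finiteMeasure_le_of_isCompact (varNorm f).toNNReal
    (isCompact_Icc (a := (0 : ι → ℝ)) (b := 1))
  have hmem (n : ℕ) : gridMeasure f n ∈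
      {μ : FiniteMeasure (ι → ℝ) | μ.mass ≤ (varNorm f).toNNReal ∧ μ (Set.Icc 0 1)ᶜ = 0} := by
    refine ⟨?_, (FiniteMeasure.null_iff_toMeasure_null _ _).2 (cellMeasure_compl_Icc f _)⟩
    rw [← ENNReal.coe_le_coe, ENNReal.coe_toNNReal hv.ne, FiniteMeasure.ennreal_mass]
    exact le_self_add.trans (cellMeasure_univ_add_neg_le f _)
  obtain ⟨P, -, hP⟩ := hcompact.ultrafilter_le_nhds ((hyperfilter ℕ).map (gridMeasure f))
    (tendsto_principal.2 (Eventually.of_forall hmem))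
  exact ⟨P, hP⟩

variable {P N : FiniteMeasure (ι → ℝ)}

lemma measureReal_box_sub_of_null_frontier (hf : IsCadlag f)
    (hP : Tendsto (gridMeasure f) (hyperfilter ℕ) (𝓝 P))
    (hN : Tendsto (gridMeasure (-f)) (hyperfilter ℕ) (𝓝 N)) {a b : ι → ℝ} (ha : 0 ≤ a)
    (hab : a ≤ b) (hnull : (P + N : Measure (ι → ℝ)) (frontier (box a b)) = 0) :
    (P : Measure (ι → ℝ)).real (box a b) - (N : Measure (ι → ℝ)).real (box a b) =
      gdiff f (a ⊓ 1) (b ⊓ 1) := by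
  rw [Measure.add_apply, add_eq_zero] at hnull
  have hlim := (tendsto_measureReal_of_null_frontier hP (measurableSet_box a b) hnull.1).sub
    (tendsto_measureReal_of_null_frontier hN (measurableSet_box a b) hnull.2)
  simp only [gridMeasure_real_box_sub_neg f _ ha hab] at hlim
  refine tendsto_nhds_unique hlim (Tendsto.mono_left ?_ Nat.hyperfilter_le_atTop)
  have hmem (c : ι → ℝ) (n : ℕ) :
      (fun i => (gridIndex (n + 1) (c i) / (n + 1 : ℕ) : ℝ)) ∈ Set.Icc (c ⊓ 1) 1 :=
    ⟨fun i => (mem_Icc_gridIndex_div (n + 1) (c i)).1, fun i => gridIndex_div_le_one (n + 1) (c i)⟩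
  exact hf.tendsto_gdiff ⟨le_inf ha zero_le_one, inf_le_right⟩
    ⟨le_inf (ha.trans hab) zero_le_one, inf_le_right⟩ (hmem a) (hmem b)
    (tendsto_pi_nhds.2 fun i => tendsto_gridIndex_div (a i))
    (tendsto_pi_nhds.2 fun i => tendsto_gridIndex_div (b i))

lemma measureReal_box_sub (hf : IsCadlag f)
    (hP : Tendsto (gridMeasure f) (hyperfilter ℕ) (𝓝 P))
    (hN : Tendsto (gridMeasure (-f)) (hyperfilter ℕ) (𝓝 N)) {a b : ι → ℝ} (ha : 0 ≤ a)
    (hab : a ≤ b) (hb : b ≤ 1) :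
    (P : Measure (ι → ℝ)).real (box a b) - (N : Measure (ι → ℝ)).real (box a b) =
      gdiff f a b := by
  obtain ⟨t, ht_pos, ht, hnull⟩ := exists_seq_null_frontier_box (P + N : Measure (ι → ℝ)) a b
  refine tendsto_nhds_unique ((tendsto_measureReal_box_add (P : Measure (ι → ℝ)) a b ht_pos ht).sub
    (tendsto_measureReal_box_add (N : Measure (ι → ℝ)) a b ht_pos ht)) ?_
  have hle (c : ι → ℝ) (n : ℕ) : c ≤ fun i => c i + t n := fun i => by
    linarith [ht_pos n]
  have hshift {c : ι → ℝ} (hc : c ≤ 1) :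
      Tendsto (fun n => (fun i => c i + t n) ⊓ 1) atTop (𝓝 c) := by
    refine tendsto_pi_nhds.2 fun i => ?_
    have hadd : Tendsto (fun n => c i + t n) atTop (𝓝 (c i)) := by
      simpa using tendsto_const_nhds.add ht
    have hmin : Tendsto (fun n => min (c i + t n) 1) atTop (𝓝 (min (c i) 1)) :=
      hadd.min tendsto_const_nhds
    rwa [min_eq_left (show c i ≤ 1 from hc i)] at hmin
  have hsub (n : ℕ) := measureReal_box_sub_of_null_frontier hf hP hN (ha.trans (hle a n))
    (fun i => by linarith [hab i]) (hnull n)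
  simp only [hsub]
  exact hf.tendsto_gdiff ⟨ha, hab.trans hb⟩ ⟨ha.trans hab, hb⟩
    (fun n => ⟨le_inf (hle a n) (hab.trans hb), inf_le_right⟩)
    (fun n => ⟨le_inf (hle b n) hb, inf_le_right⟩) (hshift (hab.trans hb)) (hshift hb)

lemma toSignedMeasure_sub_apply {Ω : Type*} [MeasurableSpace Ω] (P N : Measure Ω)
    [IsFiniteMeasure P] [IsFiniteMeasure N] {A : Set Ω} (hA : MeasurableSet A) :
    (P.toSignedMeasure - N.toSignedMeasure) A = P.real A - N.real A := by
  rw [_root_.sub_apply, Measure.toSignedMeasure_apply_measurable hA,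
    Measure.toSignedMeasure_apply_measurable hA]

theorem exists_isGeneratedBy (hf : IsCadlag f) (hv : varNorm f < ∞) :
    ∃ ν, IsGeneratedBy ν f ∧ ν.totalVariation Set.univ ≤ varNorm f := by
  obtain ⟨P, hP⟩ := exists_tendsto_gridMeasure hv
  obtain ⟨N, hN⟩ := exists_tendsto_gridMeasure ((varNorm_neg f).trans_lt hv)
  refine ⟨((P : Measure (ι → ℝ)).restrict (box 0 1)).toSignedMeasure -
      ((N : Measure (ι → ℝ)).restrict (box 0 1)).toSignedMeasure,
    ⟨fun a b ha hab hb => ?_, fun A hA hdisj => ?_⟩, ?_⟩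
  · simp only [toSignedMeasure_sub_apply _ _ (measurableSet_box a b),
      measureReal_restrict_apply (measurableSet_box a b), Set.inter_eq_left.2 (box_mono ha hb),
      measureReal_box_sub hf hP hN ha hab hb]
  · simp only [toSignedMeasure_sub_apply _ _ hA, measureReal_restrict_apply hA, hdisj.inter_eq,
      measureReal_empty, sub_zero]
  · rw [SignedMeasure.totalVariation_eq_variation]
    refine (VectorMeasure.variation_sub_le Set.univ).trans ?_
    simp only [Measure.add_apply, Measure.variation_toSignedMeasure]
    exact (add_le_add (Measure.restrict_apply_le _ _) (Measure.restrict_apply_le _ _)).trans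
      (measure_univ_add_le_of_tendsto hP hN fun n => cellMeasure_univ_add_neg_le f _)

lemma IsGeneratedBy.isGeneratedBy_dMeasure {ν : SignedMeasure (ι → ℝ)} (h : IsGeneratedBy ν f) :
    IsGeneratedBy (dMeasure f) f := by
  have hex : ∃ ν, IsGeneratedBy ν f := ⟨ν, h⟩
  rw [dMeasure, dif_pos hex]
  exact hex.choose_spec

lemma IsGeneratedBy.varNorm_le {ν : SignedMeasure (ι → ℝ)} (h : IsGeneratedBy ν f) :
    varNorm f ≤ ν.totalVariation (box 0 1) := by
  refine iSup_le fun π => ?_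
  have hbounds {J : BoxIntegral.Box ι} (hJ : J ∈ π.boxes) : 0 ≤ J.lower ∧ J.upper ≤ 1 :=
    BoxIntegral.Box.le_iff_bounds.1 (π.le_of_mem hJ)
  have hcell : ∀ J ∈ π.boxes, ENNReal.ofReal |gdiff f J.lower J.upper| ≤
      ν.totalVariation (J : Set (ι → ℝ)) := by
    intro J hJ
    rw [← h.1 J.lower J.upper (hbounds hJ).1 J.lower_le_upper (hbounds hJ).2, box,
      ← BoxIntegral.Box.coe_eq_pi, ← Real.enorm_eq_ofReal_abs]
    exact ν.enorm_le_totalVariation _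
  calc ∑ J ∈ π.boxes, ENNReal.ofReal |gdiff f J.lower J.upper|
      ≤ ∑ J ∈ π.boxes, ν.totalVariation (J : Set (ι → ℝ)) := Finset.sum_le_sum hcell
    _ = ν.totalVariation (⋃ J ∈ π.boxes, (J : Set (ι → ℝ))) :=
        (measure_biUnion_finset (fun I hI J hJ hne => π.pairwiseDisjoint hI hJ hne)
          fun J _ => J.measurableSet_coe).symm
    _ ≤ ν.totalVariation (box 0 1) := by
        refine measure_mono (Set.iUnion₂_subset fun J hJ => ?_)
        rw [BoxIntegral.Box.coe_eq_pi]
        exact box_mono (hbounds hJ).1 (hbounds hJ).2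

theorem totalVariation_dMeasure (hf : IsCadlag f) (hv : varNorm f < ∞) :
    (dMeasure f).totalVariation (box 0 1) = varNorm f := by
  obtain ⟨ν, hν, hle⟩ := exists_isGeneratedBy hf hv
  rw [hν.isGeneratedBy_dMeasure.unique hν]
  exact le_antisymm ((measure_mono (Set.subset_univ _)).trans hle) hν.varNorm_le

end Existence

section TruncatedPower

/-- The truncated power `(x - u)₊ʲ / j!`, the one-dimensional factor of `spline`. At `j = 0` it is
the indicator of `u ≤ x`, so the value at `u = x` is `1`. -/
noncomputable def truncPow (j : ℕ) (u x : ℝ) : ℝ := if u ≤ x then (x - u) ^ j / j.factorial else 0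

lemma truncPow_nonneg (j : ℕ) (u x : ℝ) : 0 ≤ truncPow j u x := by
  unfold truncPow
  split_ifs with h
  · have := sub_nonneg.2 h
    positivity
  · exact le_rfl

lemma truncPow_le_one (j : ℕ) {u x : ℝ} (hu : 0 ≤ u) (hx : x ≤ 1) : truncPow j u x ≤ 1 := by
  unfold truncPow
  split_ifs with h
  · refine div_le_one_of_le₀ ?_ (Nat.cast_nonneg _)
    exact (pow_le_one₀ (by linarith) (by linarith)).trans
      (by exact_mod_cast Nat.one_le_iff_ne_zero.2 j.factorial_ne_zero)
  · exact zero_le_one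

lemma measurable_truncPow (j : ℕ) : Measurable fun p : ℝ × ℝ => truncPow j p.1 p.2 :=
  Measurable.ite (measurableSet_le measurable_fst measurable_snd) (by fun_prop) measurable_const

lemma integral_pow_div_factorial (j : ℕ) (r : ℝ) :
    ∫ v in (0)..r, v ^ j / j.factorial = r ^ (j + 1) / (j + 1).factorial := by
  rw [intervalIntegral.integral_div, integral_pow, Nat.factorial_succ, div_div,
    zero_pow j.succ_ne_zero, sub_zero]
  push_cast
  rfl

lemma integral_truncPow_left (j : ℕ) (u x : ℝ) :
    ∫ v in Set.Ioc u x, truncPow j v x = truncPow (j + 1) u x := by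
  rcases lt_or_ge x u with h | h
  · simp [truncPow, Set.Ioc_eq_empty h.asymm, not_le.2 h]
  · calc ∫ v in Set.Ioc u x, truncPow j v x
        = ∫ v in Set.Ioc u x, (x - v) ^ j / j.factorial :=
          setIntegral_congr_fun measurableSet_Ioc fun v hv => if_pos hv.2
      _ = truncPow (j + 1) u x := by
          rw [← intervalIntegral.integral_of_le h,
            intervalIntegral.integral_comp_sub_left (fun v => v ^ j / (j.factorial : ℝ)) x,
            sub_self, integral_pow_div_factorial, truncPow, if_pos h]

lemma integral_truncPow_right (j : ℕ) {u : ℝ} (hu : 0 ≤ u) (x : ℝ) :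
    ∫ v in Set.Ioc 0 x, truncPow j u v = truncPow (j + 1) u x := by
  rcases lt_or_ge x u with h | h
  · rw [truncPow, if_neg h.not_ge]
    exact setIntegral_eq_zero_of_forall_eq_zero fun v hv => if_neg (hv.2.trans_lt h).not_ge
  · have hsupp : ∀ v, v ∈ Set.Icc 0 x \ Set.Icc u x → truncPow j u v = 0 := fun v hv =>
      if_neg fun huv => hv.2 ⟨huv, hv.1.2⟩
    calc ∫ v in Set.Ioc 0 x, truncPow j u v
        = ∫ v in Set.Icc u x, truncPow j u v := by
          rw [← integral_Icc_eq_integral_Ioc, setIntegral_eq_of_subset_of_forall_sdiff_eq_zero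
            measurableSet_Icc (Set.Icc_subset_Icc_left hu) hsupp]
      _ = ∫ v in Set.Ioc u x, (v - u) ^ j / j.factorial := by
          rw [integral_Icc_eq_integral_Ioc]
          exact setIntegral_congr_fun measurableSet_Ioc fun v hv => if_pos hv.1.le
      _ = truncPow (j + 1) u x := by
          rw [← intervalIntegral.integral_of_le h,
            intervalIntegral.integral_comp_sub_right (fun v => v ^ j / (j.factorial : ℝ)) u,
            sub_self, integral_pow_div_factorial, truncPow, if_pos h]

end TruncatedPower

section Primitive

variable {ι : Type*} [Fintype ι]

lemma setIntegral_box_prod (a b : ι → ℝ) (g : ι → ℝ → ℝ) :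
    ∫ v in box a b, ∏ i, g i (v i) = ∏ i, ∫ t in Set.Ioc (a i) (b i), g i t := by
  rw [box, volume_pi, Measure.restrict_pi_pi]
  exact integral_fintype_prod_eq_prod g

lemma spline_eq_prod (j : ℕ) (u x : ι → ℝ) : spline j u x = ∏ i, truncPow j (u i) (x i) := by
  classical
  induction j generalizing u with
  | zero =>
    simp only [spline, truncPow, pow_zero, Nat.factorial_zero, Nat.cast_one, div_one]
    rw [Finset.prod_ite_zero]
    simp [Pi.le_def]
  | succ j ih =>
    simp only [spline, ih]
    rw [setIntegral_box_prod u x fun i t => truncPow j t (x i)]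
    simp only [integral_truncPow_left]

lemma setIntegral_spline (j : ℕ) {u : ι → ℝ} (hu : 0 ≤ u) (x : ι → ℝ) :
    ∫ v in box 0 x, spline j u v = spline (j + 1) u x := by
  simp only [spline_eq_prod]
  rw [setIntegral_box_prod 0 x fun i t => truncPow j (u i) t]
  exact Finset.prod_congr rfl fun i _ => integral_truncPow_right j (hu i) (x i)

lemma spline_eq_zero (j : ℕ) {u x : ι → ℝ} (h : ¬ u ≤ x) : spline j u x = 0 := by
  rw [spline_eq_prod]
  obtain ⟨i, hi⟩ := not_forall.1 h
  exact Finset.prod_eq_zero (Finset.mem_univ i) (by rw [truncPow, if_neg hi])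

lemma abs_spline_le_one (j : ℕ) {u x : ι → ℝ} (hu : 0 ≤ u) (hx : x ≤ 1) : |spline j u x| ≤ 1 := by
  rw [spline_eq_prod, Finset.abs_prod]
  refine Finset.prod_le_one (fun i _ => abs_nonneg _) fun i _ => ?_
  rw [abs_of_nonneg (truncPow_nonneg _ _ _)]
  exact truncPow_le_one j (hu i) (hx i)

lemma measurable_spline (j : ℕ) :
    Measurable fun p : (ι → ℝ) × (ι → ℝ) => spline j p.1 p.2 := by
  simp only [spline_eq_prod]
  refine Finset.measurable_fun_prod _ fun i _ => ?_
  exact (measurable_truncPow j).comp (f := fun p : (ι → ℝ) × (ι → ℝ) => (p.1 i, p.2 i))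
    (by fun_prop)

lemma primitive_congr (j : ℕ) {f g : (ι → ℝ) → ℝ} {x : ι → ℝ} (hx : 0 ≤ x)
    (h : ∀ y ∈ Set.Icc 0 x, f y = g y) : primitive j f x = primitive j g x := by
  induction j generalizing x with
  | zero => exact h x ⟨hx, le_rfl⟩
  | succ j ih =>
    refine setIntegral_congr_fun (measurableSet_box 0 x) fun y hy => ?_
    have hy' := box_subset_Icc _ _ hy
    exact ih hy'.1 fun z hz => h z ⟨hz.1, hz.2.trans hy'.2⟩

lemma primitive_setIntegral (j : ℕ) (f : (ι → ℝ) → ℝ) (x : ι → ℝ) :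
    primitive j (fun y => ∫ z in box 0 y, f z) x = primitive (j + 1) f x := by
  induction j generalizing x with
  | zero => rfl
  | succ j ih => simp only [primitive, ih]

lemma primitive_one (j : ℕ) {x : ι → ℝ} (hx : 0 ≤ x) :
    primitive j (fun _ => 1) x = spline j 0 x := by
  induction j generalizing x with
  | zero => simp [primitive, spline, hx]
  | succ j ih =>
    rw [← setIntegral_spline j le_rfl]
    exact setIntegral_congr_fun (measurableSet_box 0 x) fun y hy =>
      ih (box_subset_Icc _ _ hy).1

lemma setIntegral_box_mul {κ κ' : Type*} [Fintype κ] [Fintype κ'] (e : κ ⊕ κ' ≃ ι)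
    (G : (κ → ℝ) → ℝ) (H : (κ' → ℝ) → ℝ) (x : ι → ℝ) :
    ∫ y in box 0 x, G (fun i => y (e (.inl i))) * H (fun i => y (e (.inr i))) =
      (∫ y in box 0 fun i => x (e (.inl i)), G y) * ∫ y in box 0 fun i => x (e (.inr i)), H y := by
  let φ : ((κ → ℝ) × (κ' → ℝ)) ≃ᵐ (ι → ℝ) :=
    (MeasurableEquiv.sumPiEquivProdPi fun _ : κ ⊕ κ' => ℝ).symm.trans
      (MeasurableEquiv.piCongrLeft (fun _ => ℝ) e)
  have hφ : MeasurePreserving φ (volume.prod volume) volume :=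
    (volume_measurePreserving_piCongrLeft (fun _ => ℝ) e).comp
      (volume_measurePreserving_sumPiEquivProdPi_symm fun _ : κ ⊕ κ' => ℝ)
  have hl : ∀ p i, φ p (e (.inl i)) = p.1 i := fun p i =>
    Equiv.piCongrLeft_apply_apply (fun _ => ℝ) e _ (.inl i)
  have hr : ∀ p i, φ p (e (.inr i)) = p.2 i := fun p i =>
    Equiv.piCongrLeft_apply_apply (fun _ => ℝ) e _ (.inr i)
  rw [← hφ.setIntegral_preimage_emb φ.measurableEmbedding]
  simp only [hl, hr]
  rw [← setIntegral_prod_mul]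
  congr 2
  ext p
  simp only [box, Set.mem_preimage, Set.mem_univ_pi, Set.mem_prod]
  rw [← e.forall_congr_right, Sum.forall]
  simp only [hl, hr]
  rfl

lemma primitive_mul {κ κ' : Type*} [Fintype κ] [Fintype κ'] (e : κ ⊕ κ' ≃ ι) (j : ℕ)
    (G : (κ → ℝ) → ℝ) (H : (κ' → ℝ) → ℝ) (x : ι → ℝ) :
    primitive j (fun y => G (fun i => y (e (.inl i))) * H (fun i => y (e (.inr i)))) x =
      primitive j G (fun i => x (e (.inl i))) * primitive j H (fun i => x (e (.inr i))) := by
  induction j generalizing x with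
  | zero => rfl
  | succ j ih =>
    simp only [primitive, ih]
    exact setIntegral_box_mul e (primitive j G) (primitive j H) x

end Primitive

section BoundedMeasurable

variable {ι : Type*}

/-- `f` agrees on the unit cube with a bounded measurable function. The values of the derivatives
outside the cube are arbitrary, so `f` itself cannot be asked to be measurable. -/
def IsBddMeas (f : (ι → ℝ) → ℝ) : Prop :=
  ∃ g : (ι → ℝ) → ℝ, Measurable g ∧ (∃ C, ∀ x, |g x| ≤ C) ∧ ∀ x ∈ Set.Icc (0 : ι → ℝ) 1, f x = g x

lemma isBddMeas_const (c : ℝ) : IsBddMeas fun _ : ι → ℝ => c :=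
  ⟨fun _ => c, measurable_const, ⟨|c|, fun _ => le_rfl⟩, fun _ _ => rfl⟩

lemma isBddMeas_of_isEmpty [IsEmpty ι] (f : (ι → ℝ) → ℝ) : IsBddMeas f :=
  (funext fun x => congrArg f (Subsingleton.elim x 0) : f = fun _ => f 0) ▸ isBddMeas_const (f 0)

lemma IsBddMeas.congr {f g : (ι → ℝ) → ℝ} (hf : IsBddMeas f)
    (h : ∀ x ∈ Set.Icc (0 : ι → ℝ) 1, g x = f x) : IsBddMeas g := by
  obtain ⟨f', hm, hC, hf'⟩ := hf
  exact ⟨f', hm, hC, fun x hx => (h x hx).trans (hf' x hx)⟩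

lemma IsBddMeas.sub {f g : (ι → ℝ) → ℝ} (hf : IsBddMeas f) (hg : IsBddMeas g) :
    IsBddMeas fun x => f x - g x := by
  obtain ⟨f', hfm, ⟨C, hC⟩, hf'⟩ := hf
  obtain ⟨g', hgm, ⟨D, hD⟩, hg'⟩ := hg
  exact ⟨fun x => f' x - g' x, hfm.sub hgm, ⟨C + D, fun x => (abs_sub _ _).trans
    (add_le_add (hC x) (hD x))⟩, fun x hx => congrArg₂ _ (hf' x hx) (hg' x hx)⟩

lemma IsBddMeas.comp {κ : Type*} {f : (κ → ℝ) → ℝ} (hf : IsBddMeas f) (l : κ → ι) :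
    IsBddMeas fun y : ι → ℝ => f fun i => y (l i) := by
  obtain ⟨g, hm, ⟨C, hC⟩, hg⟩ := hf
  refine ⟨fun y => g fun i => y (l i), hm.comp (by fun_prop), ⟨C, fun y => hC _⟩, fun y hy => ?_⟩
  exact hg _ ⟨fun i => hy.1 (l i), fun i => hy.2 (l i)⟩

lemma measurableSet_setOf_snd_mem_box_fst [Countable ι] :
    MeasurableSet {p : (ι → ℝ) × (ι → ℝ) | p.2 ∈ box 0 p.1} := by
  simp only [box, Set.mem_univ_pi, Set.ofPred_forall]
  have hfst (i : ι) : Measurable fun p : (ι → ℝ) × (ι → ℝ) => p.1 i := by fun_prop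
  have hsnd (i : ι) : Measurable fun p : (ι → ℝ) × (ι → ℝ) => p.2 i := by fun_prop
  exact .iInter fun i =>
    (measurableSet_lt measurable_const (hsnd i)).inter (measurableSet_le (hsnd i) (hfst i))

lemma IsBddMeas.setIntegral [Finite ι] {f : (ι → ℝ) → ℝ} (hf : IsBddMeas f)
    (P : Measure (ι → ℝ)) [IsFiniteMeasure (P.restrict (box 0 1))] :
    IsBddMeas fun x => ∫ y in box 0 x, f y ∂P := by
  cases nonempty_fintype ι
  obtain ⟨g, hm, ⟨C, hC⟩, hg⟩ := hf
  refine ⟨fun x => ∫ y in box 0 x, g y ∂P.restrict (box 0 1), ?_,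
    ⟨∫ y in box 0 1, |g y| ∂P, fun x => ?_⟩, fun x hx => ?_⟩
  · simp only [← integral_indicator (μ := P.restrict (box 0 1)) (measurableSet_box 0 _)]
    refine (StronglyMeasurable.integral_prod_right
      (f := fun x y => (box 0 x).indicator g y) ?_).measurable
    exact ((hm.comp measurable_snd).indicator
      measurableSet_setOf_snd_mem_box_fst).stronglyMeasurable
  · have hint : IntegrableOn g (box 0 1) P :=
      Integrable.of_bound hm.aestronglyMeasurable C (ae_of_all _ hC)
    exact abs_integral_le_integral_abs.trans
      (setIntegral_le_integral hint.abs (ae_of_all _ fun _ => abs_nonneg _))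
  · beta_reduce
    rw [Measure.restrict_restrict (measurableSet_box 0 x),
      Set.inter_eq_left.2 (box_mono le_rfl hx.2)]
    refine setIntegral_congr_fun (measurableSet_box 0 x) fun y hy => ?_
    have hy' := box_subset_Icc _ _ hy
    exact hg y ⟨hy'.1, hy'.2.trans hx.2⟩

lemma isBddMeas_measureReal_box [Finite ι] (P : Measure (ι → ℝ)) [IsFiniteMeasure P] :
    IsBddMeas fun u => P.real (box 0 u) := by
  simpa using (isBddMeas_const 1).setIntegral P

variable [Fintype ι]

lemma IsBddMeas.integrableOn {f : (ι → ℝ) → ℝ} (hf : IsBddMeas f) {x : ι → ℝ} (hx : x ≤ 1) :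
    IntegrableOn f (box 0 x) := by
  obtain ⟨g, hm, ⟨C, hC⟩, hg⟩ := hf
  have hint : IntegrableOn g (box 0 x) :=
    Integrable.of_bound hm.aestronglyMeasurable C (ae_of_all _ hC)
  refine hint.congr_fun (fun y hy => ?_) (measurableSet_box 0 x)
  have hy' := box_subset_Icc _ _ hy
  exact (hg y ⟨hy'.1, hy'.2.trans hx⟩).symm

lemma IsBddMeas.primitive {f : (ι → ℝ) → ℝ} (hf : IsBddMeas f) (j : ℕ) :
    IsBddMeas (primitive j f) := by
  induction j with
  | zero => exact hf
  | succ j ih => exact ih.setIntegral volume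

lemma primitive_sum {κ : Type*} (S : Finset κ) {f : κ → (ι → ℝ) → ℝ}
    (hf : ∀ k ∈ S, IsBddMeas (f k)) (j : ℕ) {x : ι → ℝ} (hx : x ∈ Set.Icc (0 : ι → ℝ) 1) :
    primitive j (fun y => ∑ k ∈ S, f k y) x = ∑ k ∈ S, primitive j (f k) x := by
  induction j generalizing x with
  | zero => rfl
  | succ j ih =>
    simp only [KSpline.primitive]
    rw [← integral_finsetSum _ fun k hk => ((hf k hk).primitive j).integrableOn hx.2]
    refine setIntegral_congr_fun (measurableSet_box 0 x) fun y hy => ?_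
    have hy' := box_subset_Icc _ _ hy
    exact ih ⟨hy'.1, hy'.2.trans hx.2⟩

lemma primitive_sub {f g : (ι → ℝ) → ℝ} (hf : IsBddMeas f) (hg : IsBddMeas g) (j : ℕ) {x : ι → ℝ}
    (hx : x ∈ Set.Icc (0 : ι → ℝ) 1) :
    primitive j (fun y => f y - g y) x = primitive j f x - primitive j g x := by
  induction j generalizing x with
  | zero => rfl
  | succ j ih =>
    simp only [KSpline.primitive]
    rw [← integral_sub ((hf.primitive j).integrableOn hx.2) ((hg.primitive j).integrableOn hx.2)]
    refine setIntegral_congr_fun (measurableSet_box 0 x) fun y hy => ?_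
    have hy' := box_subset_Icc _ _ hy
    exact ih ⟨hy'.1, hy'.2.trans hx.2⟩

lemma primitive_of_isEmpty [IsEmpty ι] (j : ℕ) (f : (ι → ℝ) → ℝ) (x : ι → ℝ) :
    primitive j f x = f x := by
  induction j generalizing x with
  | zero => rfl
  | succ j ih =>
    have hbox : box 0 x = Set.univ := Set.eq_univ_of_forall fun _ i => isEmptyElim i
    rw [KSpline.primitive, hbox, Measure.restrict_univ, volume_pi, Measure.pi_of_empty,
      integral_dirac, ih, Subsingleton.elim x]

end BoundedMeasurable

section SplineIntegrals

variable {ι : Type*} [Fintype ι]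

lemma measureReal_box_eq_setIntegral_spline (P : Measure (ι → ℝ)) {x : ι → ℝ} (hx : x ≤ 1) :
    P.real (box 0 x) = ∫ y in box 0 1, spline 0 y x ∂P := by
  have hindicator : Set.EqOn (fun y => spline 0 y x) ((box 0 x).indicator fun _ => 1)
      (box 0 1) := by
    classical
    intro y hy
    have hmem : y ≤ x ↔ y ∈ box 0 x :=
      ⟨fun h i _ => ⟨(hy i trivial).1, h i⟩, fun h i => (h i trivial).2⟩
    simp only [spline, Set.indicator_apply, hmem]
  rw [setIntegral_congr_fun (measurableSet_box 0 1) hindicator,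
    setIntegral_indicator (measurableSet_box 0 x),
    Set.inter_eq_right.2 (box_mono (le_refl (0 : ι → ℝ)) hx), setIntegral_const, smul_eq_mul,
    mul_one]

lemma setIntegral_setIntegral_spline (P : Measure (ι → ℝ)) [IsFiniteMeasure P] (j : ℕ) {x : ι → ℝ}
    (hx : x ≤ 1) :
    ∫ v in box 0 x, ∫ y in box 0 1, spline j y v ∂P = ∫ y in box 0 1, spline (j + 1) y x ∂P := by
  have hint : Integrable (fun p : (ι → ℝ) × (ι → ℝ) => spline j p.2 p.1)
      ((volume.restrict (box 0 x)).prod (P.restrict (box 0 1))) := by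
    refine .of_bound ((measurable_spline j).comp measurable_swap).aestronglyMeasurable 1 ?_
    rw [Measure.prod_restrict]
    filter_upwards [ae_restrict_mem ((measurableSet_box 0 x).prod (measurableSet_box 0 1))]
      with p hp
    exact abs_spline_le_one j (box_subset_Icc _ _ hp.2).1 ((box_subset_Icc _ _ hp.1).2.trans hx)
  rw [integral_integral_swap hint]
  exact setIntegral_congr_fun (measurableSet_box 0 1) fun y hy =>
    setIntegral_spline j (box_subset_Icc _ _ hy).1 x

lemma primitive_measureReal_box (P : Measure (ι → ℝ)) [IsFiniteMeasure P] (j : ℕ) {x : ι → ℝ}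
    (hx : x ≤ 1) :
    primitive j (fun u => P.real (box 0 u)) x = ∫ y in box 0 1, spline j y x ∂P := by
  induction j generalizing x with
  | zero => exact measureReal_box_eq_setIntegral_spline P hx
  | succ j ih =>
    rw [← setIntegral_setIntegral_spline P j hx]
    exact setIntegral_congr_fun (measurableSet_box 0 x) fun v hv =>
      ih ((box_subset_Icc _ _ hv).2.trans hx)

lemma setIntegral_spline_eq_primitive (P : Measure (ι → ℝ)) [IsFiniteMeasure P] (j : ℕ)
    {x : ι → ℝ} (hx : x ≤ 1) {B : Set (ι → ℝ)} (hB1 : B ⊆ box 0 1) (hBx : box 0 x ⊆ B) :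
    ∫ u in B, spline j u x ∂P = primitive j (fun u => P.real (box 0 u)) x := by
  rw [primitive_measureReal_box P j hx]
  refine (setIntegral_eq_of_subset_of_forall_sdiff_eq_zero (measurableSet_box 0 1) hB1
    fun u hu => ?_).symm
  exact spline_eq_zero j fun hux => hu.2 (hBx fun i _ => ⟨(hu.1 i trivial).1, hux i⟩)

lemma integrableOn_spline (P : Measure (ι → ℝ)) [IsFiniteMeasure P] (j : ℕ) {x : ι → ℝ}
    (hx : x ≤ 1) {B : Set (ι → ℝ)} (hB : MeasurableSet B) (hB1 : B ⊆ box 0 1) :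
    IntegrableOn (fun u => spline j u x) B P := by
  refine Integrable.of_bound ((measurable_spline j).comp
    (measurable_id.prodMk measurable_const)).aestronglyMeasurable 1 ?_
  filter_upwards [ae_restrict_mem hB] with u hu
  exact abs_spline_le_one j (box_subset_Icc _ _ (hB1 hu)).1 hx

end SplineIntegrals

section SignedMeasures

variable {Ω : Type*} [MeasurableSpace Ω]

lemma exists_eq_toSignedMeasure_sub (ν : SignedMeasure Ω) :
    ∃ P N : Measure Ω, ∃ (_ : IsFiniteMeasure P) (_ : IsFiniteMeasure N),
      ν = P.toSignedMeasure - N.toSignedMeasure :=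
  ⟨_, _, ν.toJordanDecomposition.posPart_finite, ν.toJordanDecomposition.negPart_finite,
    ν.toSignedMeasure_toJordanDecomposition.symm⟩

lemma setVectorIntegral_toSignedMeasure_sub (P N : Measure Ω) [IsFiniteMeasure P]
    [IsFiniteMeasure N] {B : Set Ω} (hB : MeasurableSet B) {g : Ω → ℝ} (hP : IntegrableOn g B P)
    (hN : IntegrableOn g B N) :
    ∫ᵛ u in B, g u ∂•(P.toSignedMeasure - N.toSignedMeasure) =
      (∫ u in B, g u ∂P) - ∫ u in B, g u ∂N := by
  have hrestrict : (P.toSignedMeasure - N.toSignedMeasure).restrict B =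
      (P.restrict B).toSignedMeasure - (N.restrict B).toSignedMeasure := by
    ext A hA
    rw [VectorMeasure.restrict_apply _ hB hA, toSignedMeasure_sub_apply _ _ (hA.inter hB),
      toSignedMeasure_sub_apply _ _ hA, measureReal_restrict_apply hA,
      measureReal_restrict_apply hA]
  -- Mathlib evaluates integrals against `toSignedMeasure` for the flipped pairing.
  have hflip : (ContinuousLinearMap.lsmul ℝ ℝ : ℝ →L[ℝ] ℝ →L[ℝ] ℝ) =
      (ContinuousLinearMap.lsmul ℝ ℝ : ℝ →L[ℝ] ℝ →L[ℝ] ℝ).flip := by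
    ext
    simp
  rw [hrestrict, VectorMeasure.integral_sub_vectorMeasure, hflip,
    VectorMeasure.integral_toSignedMeasure, VectorMeasure.integral_toSignedMeasure]
  · simpa [VectorMeasure.Integrable] using hP.integrable
  · simpa [VectorMeasure.Integrable] using hN.integrable

variable {ι : Type*}

lemma isBddMeas_signedMeasure_box [Finite ι] (ν : SignedMeasure (ι → ℝ)) :
    IsBddMeas fun u => ν (box 0 u) := by
  cases nonempty_fintype ι
  obtain ⟨P, N, _, _, rfl⟩ := exists_eq_toSignedMeasure_sub ν
  simp only [toSignedMeasure_sub_apply P N (measurableSet_box 0 _)]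
  exact (isBddMeas_measureReal_box P).sub (isBddMeas_measureReal_box N)

variable [Fintype ι]

lemma IsGeneratedBy.isBddMeas {f : (ι → ℝ) → ℝ} {ν : SignedMeasure (ι → ℝ)}
    (h : IsGeneratedBy ν f) : IsBddMeas fun u => gdiff f 0 u :=
  (isBddMeas_signedMeasure_box ν).congr fun u hu => (h.1 0 u le_rfl hu.1 hu.2).symm

lemma setVectorIntegral_spline (ν : SignedMeasure (ι → ℝ)) (j : ℕ) {x : ι → ℝ}
    (hx : x ∈ Set.Icc (0 : ι → ℝ) 1) {B : Set (ι → ℝ)} (hB : MeasurableSet B)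
    (hB1 : B ⊆ box 0 1) (hBx : box 0 x ⊆ B) :
    ∫ᵛ u in B, spline j u x ∂•ν = primitive j (fun u => ν (box 0 u)) x := by
  obtain ⟨P, N, _, _, rfl⟩ := exists_eq_toSignedMeasure_sub ν
  simp only [toSignedMeasure_sub_apply P N (measurableSet_box 0 _)]
  rw [primitive_sub (isBddMeas_measureReal_box P) (isBddMeas_measureReal_box N) j hx,
    ← setIntegral_spline_eq_primitive P j hx.2 hB1 hBx,
    ← setIntegral_spline_eq_primitive N j hx.2 hB1 hBx]
  exact setVectorIntegral_toSignedMeasure_sub P N hB (integrableOn_spline P j hx.2 hB hB1)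
    (integrableOn_spline N j hx.2 hB hB1)

end SignedMeasures

section Chains

variable {d n : ℕ}

lemma mem_chains {s : Fin n → Finset (Fin d)} : s ∈ chains d n ↔ Antitone s := by
  simp [chains]

/-- The chain `(s_1, …, s_n, t)`, through which the representation of order `n` is refined to the
one of order `n + 1`. -/
def snocChain (s : Fin n → Finset (Fin d)) (t : Finset (Fin d)) : Fin (n + 1) → Finset (Fin d) :=
  Fin.snoc (α := fun _ => Finset (Fin d)) s t

@[simp]
lemma snocChain_last (s : Fin n → Finset (Fin d)) (t : Finset (Fin d)) :
    snocChain s t (Fin.last n) = t := by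
  simp [snocChain]

@[simp]
lemma snocChain_castSucc (s : Fin n → Finset (Fin d)) (t : Finset (Fin d)) (i : Fin n) :
    snocChain s t i.castSucc = s i := by
  simp [snocChain]

lemma snocChain_mk (s : Fin n → Finset (Fin d)) (t : Finset (Fin d)) {i : ℕ} (hi : i < n) :
    snocChain s t ⟨i, hi.trans n.lt_succ_self⟩ = s ⟨i, hi⟩ :=
  snocChain_castSucc s t ⟨i, hi⟩

lemma snocChain_mem_chains {s : Fin (n + 1) → Finset (Fin d)} {t : Finset (Fin d)} :
    snocChain s t ∈ chains d (n + 2) ↔ s ∈ chains d (n + 1) ∧ t ⊆ s (Fin.last n) := by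
  rw [mem_chains, mem_chains, Fin.antitone_iff_succ_le, Fin.antitone_iff_succ_le,
    Fin.forall_fin_succ']
  simp only [Fin.succ_castSucc, snocChain_castSucc, Fin.succ_last, snocChain_last]

lemma sum_chains_one (F : (Fin 1 → Finset (Fin d)) → ℝ) :
    ∑ s ∈ chains d 1, F s = ∑ t, F fun _ => t := by
  have hchains : chains d 1 = Finset.univ :=
    Finset.eq_univ_of_forall fun s => mem_chains.2 (Subsingleton.antitone s)
  rw [hchains, ← (Equiv.funUnique (Fin 1) (Finset (Fin d))).symm.sum_comp]
  rfl

lemma sum_chains_succ (F : (Fin (n + 2) → Finset (Fin d)) → ℝ) :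
    ∑ s ∈ chains d (n + 2), F s =
      ∑ s ∈ chains d (n + 1), ∑ t ∈ (s (Fin.last n)).powerset, F (snocChain s t) := by
  have hinit (s : Fin (n + 2) → Finset (Fin d)) :
      snocChain (Fin.init s) (s (Fin.last (n + 1))) = s := Fin.snoc_init_self s
  rw [Finset.sum_sigma']
  refine (Finset.sum_bij' (fun p _ => snocChain p.1 p.2)
    (fun s _ => ⟨Fin.init s, s (Fin.last (n + 1))⟩) (fun p hp => ?_) (fun s hs => ?_)
    (fun p _ => ?_) (fun s _ => hinit s) fun _ _ => rfl).symm
  · simpa only [snocChain_mem_chains, Finset.mem_sigma, Finset.mem_powerset] using hp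
  · rw [← hinit s] at hs
    simpa only [Finset.mem_sigma, Finset.mem_powerset] using snocChain_mem_chains.1 hs
  · simp [snocChain]

lemma trunc_snocChain (s : Fin n → Finset (Fin d)) (t : Finset (Fin d)) {m : ℕ} (hm : m ≤ n) :
    trunc (snocChain s t) m = trunc s m := by
  funext i
  have hi : (i : ℕ) < n := i.2.trans_le hm
  rw [trunc, trunc, dif_pos hi, dif_pos (hi.trans n.lt_succ_self), snocChain_mk s t hi]

lemma trunc_self (s : Fin n → Finset (Fin d)) : trunc s n = s := by
  funext i
  rw [trunc, dif_pos i.2]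

lemma ne_empty_of_last_nonempty {s : Fin (n + 1) → Finset (Fin d)} (hs : s ∈ chains d (n + 1))
    (h : (s (Fin.last n)).Nonempty) (i : Fin (n + 1)) : s i ≠ ∅ :=
  (h.mono (mem_chains.1 hs (Fin.le_last i))).ne_empty

lemma firstEmpty_eq {s : Fin n → Finset (Fin d)} {m : ℕ} (hm : m < n) (h : s ⟨m, hm⟩ = ∅)
    (hlt : ∀ (i : ℕ) (hi : i < m), s ⟨i, hi.trans hm⟩ ≠ ∅) : firstEmpty s = m :=
  IsLeast.csInf_eq ⟨⟨hm, h⟩, fun i ⟨_, hi⟩ => not_lt.1 fun him => hlt i him hi⟩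

lemma exists_apply_firstEmpty_eq {s : Fin n → Finset (Fin d)} (h : ∃ i, s i = ∅) :
    ∃ hm : firstEmpty s < n, s ⟨firstEmpty s, hm⟩ = ∅ :=
  have ⟨i, hi⟩ := h
  Nat.sInf_mem (s := {m | ∃ h : m < n, s ⟨m, h⟩ = ∅}) ⟨i, i.2, hi⟩

lemma apply_ne_empty_of_lt_firstEmpty {s : Fin n → Finset (Fin d)} {i : ℕ} (hi : i < firstEmpty s)
    (hin : i < n) : s ⟨i, hin⟩ ≠ ∅ :=
  fun h => Nat.notMem_of_lt_sInf hi ⟨hin, h⟩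

lemma constCoef_snocChain_of_exists (q : Family d) {s : Fin n → Finset (Fin d)}
    (h : ∃ i, s i = ∅) (t : Finset (Fin d)) : constCoef q (snocChain s t) = constCoef q s := by
  obtain ⟨hm, hempty⟩ := exists_apply_firstEmpty_eq h
  have hfirst : firstEmpty (snocChain s t) = firstEmpty s := by
    refine firstEmpty_eq (hm.trans n.lt_succ_self) ?_ fun i hi => ?_
    · rwa [snocChain_mk s t hm]
    · rw [snocChain_mk s t (hi.trans hm)]
      exact apply_ne_empty_of_lt_firstEmpty hi _
  rw [constCoef, hfirst, trunc_snocChain s t hm.le, constCoef]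

lemma constCoef_eq_of_last_eq_empty (q : Family d) {s : Fin (n + 1) → Finset (Fin d)}
    (hlast : s (Fin.last n) = ∅) (hinit : ∀ i : Fin n, s i.castSucc ≠ ∅) :
    constCoef q s = q n (trunc s n) 0 := by
  rw [constCoef, firstEmpty_eq n.lt_succ_self hlast fun i hi => hinit ⟨i, hi⟩]

end Chains

section EdgeFactors

variable {d n : ℕ}

/-- The spline `φ_0^j(x(A))`, with the set `A` as an explicit argument so that it can be rewritten
without transporting `sub A x` along an equality of index types. -/
noncomputable def edgeSpline (j : ℕ) (A : Finset (Fin d)) (x : Fin d → ℝ) : ℝ :=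
  spline j 0 (sub A x)

lemma edgeSpline_empty (j : ℕ) (x : Fin d → ℝ) : edgeSpline j ∅ x = 1 := by
  simp [edgeSpline, spline_eq_prod]

-- The factors excluded by the side condition `s j ≠ ∅` of `phiBar` are empty products.
lemma phiBar_eq_prod (s : Fin (n + 1) → Finset (Fin d)) (x : Fin d → ℝ) :
    phiBar s x = ∏ j : Fin n, edgeSpline (j + 1) (s j.castSucc \ s j.succ) x := by
  refine (Finset.prod_filter _ _).trans (Finset.prod_congr rfl fun j _ => ?_)
  split_ifs with h
  · rfl
  · rw [Finset.not_nonempty_iff_eq_empty.1 h, Finset.empty_sdiff, edgeSpline_empty]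

lemma phiBar_snocChain (s : Fin (n + 1) → Finset (Fin d)) (t : Finset (Fin d)) (x : Fin d → ℝ) :
    phiBar (snocChain s t) x = phiBar s x * edgeSpline (n + 1) (s (Fin.last n) \ t) x := by
  simp only [phiBar_eq_prod]
  rw [Fin.prod_univ_castSucc]
  simp only [Fin.succ_castSucc, snocChain_castSucc, Fin.succ_last, snocChain_last, Fin.val_castSucc,
    Fin.val_last]

lemma phiBar_trunc_firstEmpty {s : Fin (n + 1) → Finset (Fin d)} (hs : s ∈ chains d (n + 1))
    (h : s (Fin.last n) = ∅) (x : Fin d → ℝ) :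
    phiBar (trunc s (firstEmpty s + 1)) x = phiBar s x := by
  obtain ⟨hm, hempty⟩ := exists_apply_firstEmpty_eq ⟨_, h⟩
  let S (j : ℕ) : Finset (Fin d) := if hj : j < n + 1 then s ⟨j, hj⟩ else ∅
  have hphiBar (m : ℕ) : phiBar (trunc s (m + 1)) x =
      ∏ j ∈ Finset.range m, edgeSpline (j + 1) (S j \ S (j + 1)) x := by
    rw [phiBar_eq_prod, Finset.prod_range]
    rfl
  rw [hphiBar, ← trunc_self s, hphiBar, trunc_self]
  refine Finset.prod_subset (Finset.range_subset_range.2 (Nat.lt_succ_iff.1 hm)) fun j hj hjm => ?_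
  rw [Finset.mem_range] at hj hjm
  have hSj : S j = ∅ := by
    rw [← Finset.subset_empty, ← hempty]
    simp only [S, dif_pos (hj.trans n.lt_succ_self)]
    exact mem_chains.1 hs (not_lt.1 hjm)
  rw [hSj, Finset.empty_sdiff, edgeSpline_empty]

end EdgeFactors

section FacePrimitives

variable {d : ℕ}

lemma sub_mem_Icc (s : Finset (Fin d)) {x : Fin d → ℝ} (hx : x ∈ Set.Icc (0 : Fin d → ℝ) 1) :
    sub s x ∈ Set.Icc (0 : s → ℝ) 1 :=
  ⟨fun i => hx.1 i, fun i => hx.2 i⟩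

lemma sub_zeroExt {t S : Finset (Fin d)} (ht : t ⊆ S) (y : S → ℝ) :
    sub t (zeroExt S y) = fun i : t => y ⟨i, ht i.2⟩ := by
  funext i
  rw [sub, zeroExt, dif_pos (ht i.2)]

lemma gdiff_sect_empty (g : (Fin d → ℝ) → ℝ) (u : (∅ : Finset (Fin d)) → ℝ) :
    gdiff (sect ∅ g) 0 u = g 0 := by
  have hzero (v : (∅ : Finset (Fin d)) → ℝ) : zeroExt ∅ v = 0 := rfl
  simp [gdiff, sect, hzero, Finset.eq_empty_of_isEmpty]

/-- The `n`-th order primitive on the face of `t` of the function `u ↦ Δ_{(0, u]}` of the section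
of `g`; for `t = ∅` it is the constant `g 0`. -/
noncomputable def facePrimitive (n : ℕ) (t : Finset (Fin d)) (g : (Fin d → ℝ) → ℝ)
    (x : Fin d → ℝ) : ℝ :=
  primitive n (fun u => gdiff (sect t g) 0 u) (sub t x)

lemma facePrimitive_empty (n : ℕ) (g : (Fin d → ℝ) → ℝ) (x : Fin d → ℝ) :
    facePrimitive n ∅ g x = g 0 := by
  rw [facePrimitive, primitive_of_isEmpty, gdiff_sect_empty]

lemma primitive_sub_zeroExt {t S : Finset (Fin d)} (ht : t ⊆ S) (j : ℕ) (G : (t → ℝ) → ℝ)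
    {x : Fin d → ℝ} (hx : 0 ≤ x) :
    primitive j (fun y => G (sub t (zeroExt S y))) (sub S x) =
      edgeSpline j (S \ t) x * primitive j G (sub t x) := by
  obtain ⟨r, hdisj, rfl⟩ : ∃ r, Disjoint t r ∧ t ∪ r = S :=
    ⟨S \ t, Finset.disjoint_sdiff, Finset.union_sdiff_of_subset ht⟩
  have hmul := primitive_mul (Equiv.Finset.union t r hdisj) j G (fun _ => 1) (sub (t ∪ r) x)
  rw [primitive_one j (x := fun i => sub (t ∪ r) x (Equiv.Finset.union t r hdisj (.inr i)))
    fun i => hx _] at hmul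
  simp only [mul_one] at hmul
  simp only [sub_zeroExt ht, Finset.union_sdiff_cancel_left hdisj]
  exact hmul.trans (mul_comm _ _)

lemma primitive_sect_eq_sum (j : ℕ) {S : Finset (Fin d)} {g : (Fin d → ℝ) → ℝ}
    (hg : ∀ t ⊆ S, IsBddMeas fun u => gdiff (sect t g) 0 u) {x : Fin d → ℝ}
    (hx : x ∈ Set.Icc (0 : Fin d → ℝ) 1) :
    primitive j (sect S g) (sub S x) =
      ∑ t ∈ S.powerset, edgeSpline j (S \ t) x * facePrimitive j t g x := by
  have hbdd : ∀ t ∈ S.powerset,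
      IsBddMeas fun y : S → ℝ => gdiff (sect t g) 0 (sub t (zeroExt S y)) := fun t ht => by
    have ht' := Finset.mem_powerset.1 ht
    simp only [sub_zeroExt ht']
    exact (hg t ht').comp fun i : t => (⟨i, ht' i.2⟩ : S)
  rw [funext (sect_eq_sum_gdiff g S), primitive_sum S.powerset hbdd j (sub_mem_Icc S hx)]
  exact Finset.sum_congr rfl fun t ht =>
    primitive_sub_zeroExt (Finset.mem_powerset.1 ht) j (gdiff (sect t g) 0) hx.1

end FacePrimitives

section Derivatives

lemma IsRNDeriv.primitive_gdiff {ι : Type*} [Fintype ι] {f g : (ι → ℝ) → ℝ} (h : IsRNDeriv f g)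
    (n : ℕ) {x : ι → ℝ} (hx : x ∈ Set.Icc (0 : ι → ℝ) 1) :
    primitive n (gdiff f 0) x = primitive (n + 1) g x := by
  rw [← primitive_setIntegral]
  refine primitive_congr n hx.1 fun u hu => ?_
  have hu1 := hu.2.trans hx.2
  rw [← h.2.1 0 u le_rfl hu.1 hu1, withDensityᵥ_apply h.1 (measurableSet_box 0 u),
    Measure.restrict_restrict (measurableSet_box 0 u), Set.inter_eq_left.2 (box_mono le_rfl hu1)]

variable {d n k : ℕ} {Q : (Fin d → ℝ) → ℝ} {q : Family d}

lemma IsDerivFamily.isGeneratedBy (hq : IsDerivFamily k Q q) (hn : n ≤ k)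
    {s : Fin (n + 1) → Finset (Fin d)} (hs : s ∈ chains d (n + 1))
    (hne : (s (Fin.last n)).Nonempty) : IsGeneratedBy (dMeasure (topSect q s)) (topSect q s) := by
  rcases hn.lt_or_eq with hlt | rfl
  · exact (hq.deriv n hlt s hs hne).2.isGeneratedBy_dMeasure
  · obtain ⟨ν, hν, -⟩ := exists_isGeneratedBy (hq.cadlag s hs hne) (hq.finite s hs hne)
    exact hν.isGeneratedBy_dMeasure

lemma IsDerivFamily.isBddMeas_gdiff (hq : IsDerivFamily k Q q) (hn : n < k)
    {s : Fin (n + 1) → Finset (Fin d)} (hs : s ∈ chains d (n + 1)) {t : Finset (Fin d)}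
    (ht : t ⊆ s (Fin.last n)) : IsBddMeas fun u => gdiff (sect t (q (n + 1) s)) 0 u := by
  rcases t.eq_empty_or_nonempty with rfl | hne
  · exact isBddMeas_of_isEmpty _
  · have hgen := hq.isGeneratedBy (n := n + 1) hn (snocChain_mem_chains.2 ⟨hs, ht⟩)
      (by rwa [snocChain_last])
    rw [topSect, snocChain_last, trunc_snocChain s t le_rfl, trunc_self] at hgen
    exact hgen.isBddMeas

lemma IsDerivFamily.primPart_eq_facePrimitive (hq : IsDerivFamily k Q q) (hn : n ≤ k)
    {s : Fin (n + 1) → Finset (Fin d)} (hs : s ∈ chains d (n + 1))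
    (hinit : ∀ i : Fin n, s i.castSucc ≠ ∅) {x : Fin d → ℝ}
    (hx : x ∈ Set.Icc (0 : Fin d → ℝ) 1) :
    primPart q s x = facePrimitive n (s (Fin.last n)) (q n (trunc s n)) x := by
  rw [primPart]
  split_ifs with hlast
  · rw [hlast, facePrimitive_empty, constCoef_eq_of_last_eq_empty q hlast hinit]
  · have hgen := hq.isGeneratedBy hn hs (Finset.nonempty_iff_ne_empty.2 hlast)
    have hx' := sub_mem_Icc (s (Fin.last n)) hx
    exact primitive_congr n hx'.1 fun u hu => hgen.1 0 u le_rfl hu.1 (hu.2.trans hx'.2)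

lemma IsDerivFamily.primPart_eq_sum (hq : IsDerivFamily k Q q) (hn : n < k)
    {s : Fin (n + 1) → Finset (Fin d)} (hs : s ∈ chains d (n + 1)) {x : Fin d → ℝ}
    (hx : x ∈ Set.Icc (0 : Fin d → ℝ) 1) :
    primPart q s x = ∑ t ∈ (s (Fin.last n)).powerset,
      edgeSpline (n + 1) (s (Fin.last n) \ t) x * primPart q (snocChain s t) x := by
  rcases (s (Fin.last n)).eq_empty_or_nonempty with hempty | hne
  · rw [hempty, Finset.powerset_empty, Finset.sum_singleton, Finset.sdiff_self, edgeSpline_empty,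
      one_mul, primPart, if_pos hempty, primPart, if_pos (snocChain_last s ∅),
      constCoef_snocChain_of_exists q ⟨_, hempty⟩]
  · have hs_ne := ne_empty_of_last_nonempty hs hne
    have hextend : ∀ t ∈ (s (Fin.last n)).powerset,
        primPart q (snocChain s t) x = facePrimitive (n + 1) t (q (n + 1) s) x := fun t ht => by
      rw [hq.primPart_eq_facePrimitive hn
        (snocChain_mem_chains.2 ⟨hs, Finset.mem_powerset.1 ht⟩)
        (fun i => by rw [snocChain_castSucc]; exact hs_ne i) hx,
        snocChain_last, trunc_snocChain s t le_rfl, trunc_self]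
    calc primPart q s x = primitive n (gdiff (topSect q s) 0) (sub (s (Fin.last n)) x) :=
          hq.primPart_eq_facePrimitive hn.le hs (fun i => hs_ne i.castSucc) hx
      _ = primitive (n + 1) (sect (s (Fin.last n)) (q (n + 1) s)) (sub (s (Fin.last n)) x) :=
          (hq.deriv n hn s hs hne).primitive_gdiff n (sub_mem_Icc _ hx)
      _ = ∑ t ∈ (s (Fin.last n)).powerset,
            edgeSpline (n + 1) (s (Fin.last n) \ t) x * facePrimitive (n + 1) t (q (n + 1) s) x :=
          primitive_sect_eq_sum (n + 1) (fun t ht => hq.isBddMeas_gdiff hn hs ht) hx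
      _ = _ := Finset.sum_congr rfl fun t ht => by rw [hextend t ht]

end Derivatives

section Representation

variable {d n k : ℕ} {Q : (Fin d → ℝ) → ℝ} {q : Family d}

lemma IsDerivFamily.eq_sum_primPart_zero (hq : IsDerivFamily k Q q) {x : Fin d → ℝ}
    (hx : x ∈ Set.Icc (0 : Fin d → ℝ) 1) :
    Q x = ∑ s ∈ chains d 1, phiBar s x * primPart q s x := by
  have hzeroExt : zeroExt Finset.univ (sub Finset.univ x) = x := by
    funext i
    simp [zeroExt, sub]
  have hQ : Q x = sect Finset.univ (q 0 Fin.elim0) (sub Finset.univ x) := by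
    rw [sect, hzeroExt, hq.zero _ x hx]
  rw [hQ, sect_eq_sum_gdiff, hzeroExt, Finset.powerset_univ, sum_chains_one]
  refine Finset.sum_congr rfl fun t _ => ?_
  rw [phiBar_eq_prod, Fin.prod_univ_zero, one_mul, hq.primPart_eq_facePrimitive k.zero_le
    (mem_chains.2 antitone_const) (fun i => i.elim0) hx, Subsingleton.elim (trunc _ 0) Fin.elim0]
  rfl

theorem IsDerivFamily.eq_sum_primPart (hq : IsDerivFamily k Q q) (hn : n ≤ k) {x : Fin d → ℝ}
    (hx : x ∈ Set.Icc (0 : Fin d → ℝ) 1) :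
    Q x = ∑ s ∈ chains d (n + 1), phiBar s x * primPart q s x := by
  induction n with
  | zero => exact hq.eq_sum_primPart_zero hx
  | succ n ih =>
    rw [ih (Nat.le_of_succ_le hn), sum_chains_succ]
    refine Finset.sum_congr rfl fun s hs => ?_
    simp only [hq.primPart_eq_sum hn hs hx, Finset.mul_sum, phiBar_snocChain, mul_assoc]

lemma splinePart_eq_primPart (q : Family d) (s : Fin (n + 1) → Finset (Fin d)) {x : Fin d → ℝ}
    (hx : x ∈ Set.Icc (0 : Fin d → ℝ) 1) {B : Set (s (Fin.last n) → ℝ)} (hB : MeasurableSet B)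
    (hB1 : B ⊆ box 0 1) (hBx : box 0 (sub (s (Fin.last n)) x) ⊆ B) :
    splinePart q s B x = primPart q s x := by
  rw [splinePart, primPart, splineInt, setVectorIntegral_spline _ n (sub_mem_Icc _ hx) hB hB1 hBx]
  rfl

lemma splinePart_box_sub (q : Family d) (s : Fin (n + 1) → Finset (Fin d)) {x : Fin d → ℝ}
    (hx : x ∈ Set.Icc (0 : Fin d → ℝ) 1) :
    splinePart q s (box 0 (sub (s (Fin.last n)) x)) x = primPart q s x :=
  splinePart_eq_primPart q s hx (measurableSet_box _ _) (box_mono le_rfl (sub_mem_Icc _ hx).2)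
    subset_rfl

lemma splinePart_box_one (q : Family d) (s : Fin (n + 1) → Finset (Fin d)) {x : Fin d → ℝ}
    (hx : x ∈ Set.Icc (0 : Fin d → ℝ) 1) : splinePart q s (box 0 1) x = primPart q s x :=
  splinePart_eq_primPart q s hx (measurableSet_box _ _) subset_rfl
    (box_mono le_rfl (sub_mem_Icc _ hx).2)

lemma sum_phiBar_mul_eq_add {a b c : (Fin (n + 1) → Finset (Fin d)) → ℝ}
    (ha : ∀ s, s (Fin.last n) = ∅ → c s = a s) (hb : ∀ s, s (Fin.last n) ≠ ∅ → c s = b s)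
    (x : Fin d → ℝ) :
    ∑ s ∈ chains d (n + 1), phiBar s x * c s =
      (∑ s ∈ chains d (n + 1) with s (Fin.last n) = ∅,
        phiBar (trunc s (firstEmpty s + 1)) x * a s) +
      ∑ s ∈ chains d (n + 1) with s (Fin.last n) ≠ ∅, phiBar s x * b s := by
  rw [← Finset.sum_filter_add_sum_filter_not (chains d (n + 1)) fun s => s (Fin.last n) = ∅]
  congr 1 <;> refine Finset.sum_congr rfl fun s hs => ?_ <;> rw [Finset.mem_filter] at hs
  · rw [phiBar_trunc_firstEmpty hs.1 hs.2, ha s hs.2]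
  · rw [hb s hs.2]

theorem IsDerivFamily.sum_coef_eq_sectVarNorm (hq : IsDerivFamily k Q q) :
    (∑ s ∈ chains d (k + 1) with s (Fin.last k) = ∅, ENNReal.ofReal |constCoef q s|) +
        ∑ s ∈ chains d (k + 1) with s (Fin.last k) ≠ ∅,
          (dMeasure (topSect q s)).totalVariation (box 0 1) =
      sectVarNorm k q := by
  rw [sectVarNorm,
    ← Finset.sum_filter_add_sum_filter_not (chains d (k + 1)) fun s => s (Fin.last k) = ∅]
  congr 1 <;> refine Finset.sum_congr rfl fun s hs => ?_ <;> rw [Finset.mem_filter] at hs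
  · rw [if_pos hs.2]
  · have hne := Finset.nonempty_iff_ne_empty.2 hs.2
    rw [if_neg hs.2, totalVariation_dMeasure (hq.cadlag s hs.1 hne) (hq.finite s hs.1 hne)]

end Representation

end KSpline

theorem mainTheorem1 {d k : ℕ} (hk : 1 ≤ k) (Q : (Fin d → ℝ) → ℝ) (hQ : Q ∈ smoothClass d k)
    (q : Family d) (hq : IsDerivFamily k Q q) :
    -- every section of a top-order derivative generates a (unique) signed measure
    (∀ s ∈ chains d (k + 1), (s (Fin.last k)).Nonempty →
      IsGeneratedBy (dMeasure (topSect q s)) (topSect q s)) ∧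
    -- spline representation, with the convention for chains that reach the empty set
    (∀ x ∈ Set.Icc (0 : Fin d → ℝ) 1,
      Q x = ∑ s ∈ chains d (k + 1),
        phiBar s x * splinePart q s (box 0 (sub (s (Fin.last k)) x)) x) ∧
    (∀ x ∈ Set.Icc (0 : Fin d → ℝ) 1,
      Q x = ∑ s ∈ chains d (k + 1), phiBar s x * splinePart q s (box 0 1) x) ∧
    -- the same with the constant terms displayed
    (∀ x ∈ Set.Icc (0 : Fin d → ℝ) 1,
      Q x = (∑ s ∈ chains d (k + 1) with s (Fin.last k) = ∅,
          phiBar (trunc s (firstEmpty s + 1)) x * constCoef q s) +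
        ∑ s ∈ chains d (k + 1) with s (Fin.last k) ≠ ∅,
          phiBar s x * splineInt q s (box 0 1) x) ∧
    -- representation by `k`-th order primitives
    (∀ x ∈ Set.Icc (0 : Fin d → ℝ) 1,
      Q x = ∑ s ∈ chains d (k + 1), phiBar s x * primPart q s x) ∧
    (∀ x ∈ Set.Icc (0 : Fin d → ℝ) 1,
      Q x = (∑ s ∈ chains d (k + 1) with s (Fin.last k) = ∅,
          phiBar (trunc s (firstEmpty s + 1)) x * constCoef q s) +
        ∑ s ∈ chains d (k + 1) with s (Fin.last k) ≠ ∅,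
          phiBar s x * primitive k (tildeQ q s) (sub (s (Fin.last k)) x)) ∧
    -- the `L₁`-norm of the coefficients is the `k`-th order sectional variation norm
    (∑ s ∈ chains d (k + 1) with s (Fin.last k) = ∅, ENNReal.ofReal |constCoef q s|) +
        ∑ s ∈ chains d (k + 1) with s (Fin.last k) ≠ ∅,
          (dMeasure (topSect q s)).totalVariation (box 0 1) =
      sectVarNorm k q := by
  have hrepr := fun x (hx : x ∈ Set.Icc (0 : Fin d → ℝ) 1) => hq.eq_sum_primPart le_rfl hx
  have hspline : ∀ x ∈ Set.Icc (0 : Fin d → ℝ) 1,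
      Q x = ∑ s ∈ chains d (k + 1), phiBar s x * splinePart q s (box 0 1) x := fun x hx => by
    simp only [splinePart_box_one q _ hx]
    exact hrepr x hx
  refine ⟨fun s hs hne => hq.isGeneratedBy le_rfl hs hne, fun x hx => ?_, hspline,
    fun x hx => ?_, hrepr, fun x hx => ?_, hq.sum_coef_eq_sectVarNorm⟩
  · simp only [splinePart_box_sub q _ hx]
    exact hrepr x hx
  · exact (hspline x hx).trans
      (sum_phiBar_mul_eq_add (fun s h => if_pos h) (fun s h => if_neg h) x)
  · exact (hrepr x hx).trans
      (sum_phiBar_mul_eq_add (fun s h => if_pos h) (fun s h => if_neg h) x)
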